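/- Let $d\ge 1$, $\alpha>0$, and equip $\mathbb{R}^{\mathbb{Z}^d}$ with the product $\sigma$-algebra. For $\boldsymbol{x}\in\mathbb{R}^{\mathbb{Z}^d}$ and $\boldsymbol{k}\in\mathbb{Z}^d$ put $\theta_{\boldsymbol{k}}\boldsymbol{x}=(x_{\boldsymbol{i}+\boldsymbol{k}})_{\boldsymbol{i}\in\mathbb{Z}^d}$ and $\mathrm{e}(\boldsymbol{x})=\{\boldsymbol{k}\in\mathbb{Z}^d:|x_{\boldsymbol{k}}|>1\}$, and let $\mathbb{R}^{\mathbb{Z}^d}_0=\{\boldsymbol{x}:\boldsymbol{0}\in\mathrm{e}(\boldsymbol{x})\}$. **Exceedance-stationarity.** Let $B\subseteq\mathbb{R}^{\mathbb{Z}^d}_0$ be a Borel set such that $\theta_{\boldsymbol{k}}\boldsymbol{x}\in B$ whenever $\boldsymbol{x}\in B$ and $\boldsymbol{k}\in\mathrm{e}(\boldsymbol{x})$. A bijective exceedance-map on $B$ is a measurable map $\tau:B\to\mathbb{Z}^d$ such that, for every $\boldsymbol{x}\in B$, $\tau(\boldsymbol{x})\in\mathrm{e}(\boldsymbol{x})$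 and $\boldsymbol{k}\mapsto\boldsymbol{k}+\tau(\theta_{\boldsymbol{k}}\boldsymbol{x})$ is a bijection of $\mathrm{e}(\boldsymbol{x})$ onto itself. A random element $\boldsymbol{Y}$ of $\mathbb{R}^{\mathbb{Z}^d}_0$ is *exceedance-stationary* if $\theta_{\tau(\boldsymbol{Y})}\boldsymbol{Y}$ and $\boldsymbol{Y}$ have the same distribution for every such $B$ with $\mathbb{P}(\boldsymbol{Y}\in B)=1$ and every bijective exceedance-map $\tau$ on $B$. **Regular variation.** A random vector $V$ in $\mathbb{R}^n$ is regularly varying with index $\alpha$ if $\mathbb{P}(\|V\|_\infty>u)>0$ for all $u$ and there is a nonzero Borel measure $\mu$ on $\mathbb{R}^n\setminus\{0\}$, finite on the complement of every neighbourhood of $0$, with $\mu(tA)=t^{-\alpha}\mu(A)$ for all $t>0$ and Borel $A$, such that $\mathbb{E}[f(V/u)]/\mathbb{P}(\|V\|_\infty>u)\to\int f\,d\mu$ as $u\to\infty$ for every bounded continuous $f$ vanishing in a neighbourhood of $0$. A random field $\boldsymbol{X}=(X_{\boldsymbol{i}})_{\boldsymbol{i}\in\mathbb{Z}^d}$ is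 regularly varying with tail index $\alpha$ if for every finite nonempty $I\subset\mathbb{Z}^d$ the vector $(X_{\boldsymbol{i}})_{\boldsymbol{i}\in I}$ is regularly varying with index $\alpha$. **Tail process.** $\boldsymbol{Y}$ is the tail process of a (strictly) stationary random field $\boldsymbol{X}$ if $|Y_{\boldsymbol{0}}|>1$ almost surely, $\mathbb{P}(|X_{\boldsymbol{0}}|>u)>0$ for all $u$, and for every $m\in\mathbb{N}$ the conditional distribution of $(u^{-1}X_{\boldsymbol{i}})_{\boldsymbol{i}\in\{-m,\dots,m\}^d}$ given $|X_{\boldsymbol{0}}|>u$ converges weakly, as $u\to\infty$, to the distribution of $(Y_{\boldsymbol{i}})_{\boldsymbol{i}\in\{-m,\dots,m\}^d}$. **Statement.** Let $\boldsymbol{Y}$ be a random element of $\mathbb{R}^{\mathbb{Z}^d}_0$. Then $\boldsymbol{Y}$ is the tail process of some strictly stationary real-valued random field $(X_{\boldsymbol{i}})_{\boldsymbol{i}\in\mathbb{Z}^d}$ that is regularly varying with tail index $\alpha$ if and only if $\boldsymbol{Y}$ is exceedance-stationary, $|Y_{\boldsymbol{0}}|$ is $\mathrm{Pareto}(\alpha)$-distributed,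 i.e. $\mathbb{P}(|Y_{\boldsymbol{0}}|>y)=y^{-\alpha}$ for all $y\ge 1$, and $|Y_{\boldsymbol{0}}|$ is independent of $\boldsymbol{Y}/|Y_{\boldsymbol{0}}|$. -/

import Mathlib

open MeasureTheory ProbabilityTheory Filter Topology
open scoped ENNReal BoundedContinuousFunction

namespace TailField

/-- The space `ℝ^(ℤ^d)`, with the product `σ`-algebra. -/
abbrev Field (d : ℕ) : Type := (Fin d → ℤ) → ℝ

/-- The shift `(θ_k x)_i = x_(i+k)`, which moves the origin to `k`. -/
def shift {d : ℕ} (k : Fin d → ℤ) (x : Field d) : Field d := fun i => x (i + k)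

/-- The set `e(x)` of exceedance-points of `x`. -/
def exc {d : ℕ} (x : Field d) : Set (Fin d → ℤ) := {k | 1 < |x k|}

/-- The set of fields with an exceedance-point at the origin. -/
def R0 (d : ℕ) : Set (Field d) := {x | 0 ∈ exc x}

/-- `τ` is an exceedance-map on the Borel set `B ⊆ R0 d`. Only the values of `τ` on `B` matter. -/
structure IsExceedanceMap {d : ℕ} (B : Set (Field d)) (τ : Field d → Fin d → ℤ) : Prop where
  measurableSet : MeasurableSet B
  subset_R0 : B ⊆ R0 d
  measurable : Measurable (B.domRestrict τ)
  mem_exc : ∀ x ∈ B, τ x ∈ exc x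

/-- The exceedance-map `τ` is bijective on `B`: the set `B` is invariant under moving the origin to
an exceedance-point, and `k ↦ k + τ (θ_k x)` is a bijection of `e(x)` for every `x ∈ B`. -/
structure IsBijectiveExceedanceMap {d : ℕ} (B : Set (Field d)) (τ : Field d → Fin d → ℤ) : Prop
    extends IsExceedanceMap B τ where
  shift_mem : ∀ x ∈ B, ∀ k ∈ exc x, shift k x ∈ B
  bijOn : ∀ x ∈ B, Set.BijOn (fun k => k + τ (shift k x)) (exc x) (exc x)

/-- `Y` is exceedance-stationary: `θ_τ Y`, that is `Y` with the origin moved to `τ(Y)`, has the same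
distribution as `Y` for every exceedance-map `τ` that is bijective on a set which carries `Y`. -/
def IsExceedanceStationary {d : ℕ} {Ω : Type*} [MeasurableSpace Ω] (P : Measure Ω)
    (Y : Ω → Field d) : Prop :=
  ∀ (B : Set (Field d)) (τ : Field d → Fin d → ℤ), IsBijectiveExceedanceMap B τ →
    (∀ᵐ ω ∂P, Y ω ∈ B) →
    IdentDistrib (fun ω => shift (τ (Y ω)) (Y ω)) Y P P

/-- Strict stationarity. -/
def IsStationary {d : ℕ} {Ω : Type*} [MeasurableSpace Ω] (P : Measure Ω) (X : Ω → Field d) : Prop :=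
  ∀ k : Fin d → ℤ, IdentDistrib (fun ω => shift k (X ω)) X P P

/-- The random vector `V` is regularly varying with index `α`: `P(V/u ∈ ·) / P(‖V‖ > u)` converges,
as `u → ∞`, to a nonzero measure `μ` on `ℝ^I ∖ {0}` that is finite on the complements of
neighbourhoods of `0`, with bounded continuous functions vanishing near `0` as test functions, and
`μ` is homogeneous of order `-α`, i.e. `μ (t⁻¹ A) = t ^ α μ A`. -/
def IsRegularlyVaryingVector {I : Type*} [Fintype I] {Ω : Type*} [MeasurableSpace Ω]
    (P : Measure Ω) (V : Ω → I → ℝ) (α : ℝ) : Prop :=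
  (∀ u : ℝ, 0 < P {ω | u < ‖V ω‖}) ∧
  ∃ μ : Measure (I → ℝ), μ ≠ 0 ∧ μ {0} = 0 ∧
    (∀ ε : ℝ, 0 < ε → μ {x | ε ≤ ‖x‖} < ∞) ∧
    (∀ t : ℝ, 0 < t → ∀ A : Set (I → ℝ), MeasurableSet A →
      μ {x | t • x ∈ A} = ENNReal.ofReal (t ^ α) * μ A) ∧
    ∀ f : (I → ℝ) →ᵇ ℝ, (∃ ε : ℝ, 0 < ε ∧ ∀ x, ‖x‖ < ε → f x = 0) →
      Tendsto (fun u : ℝ => (∫ ω, f (u⁻¹ • V ω) ∂P) / P.real {ω | u < ‖V ω‖}) atTop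
        (𝓝 (∫ x, f x ∂μ))

/-- The random field `X` is regularly varying with tail index `α`: so are all its
finite-dimensional vectors. -/
def IsRegularlyVaryingField {d : ℕ} {Ω : Type*} [MeasurableSpace Ω] (P : Measure Ω)
    (X : Ω → Field d) (α : ℝ) : Prop :=
  ∀ I : Finset (Fin d → ℤ), I.Nonempty →
    IsRegularlyVaryingVector P (fun ω (i : I) => X ω i) α

/-- The box `{-m, …, m}^d`. -/
noncomputable def box (d m : ℕ) : Finset (Fin d → ℤ) := Finset.Icc (fun _ => -(m : ℤ)) (fun _ => (m : ℤ))

/-- `Y` is the tail process of `X`: almost surely `|Y_0| > 1`, and on each box, the conditional law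
of `X/u` given `|X_0| > u` converges weakly to the law of `Y` as `u → ∞`. -/
structure IsTailProcess {d : ℕ} {Ω' Ω : Type*} [MeasurableSpace Ω'] [MeasurableSpace Ω]
    (P' : Measure Ω') (X : Ω' → Field d) (P : Measure Ω) (Y : Ω → Field d) : Prop where
  exceeds : ∀ᵐ ω ∂P, 1 < |Y ω 0|
  pos : ∀ u : ℝ, 0 < P' {ω | u < |X ω 0|}
  tendsto : ∀ m : ℕ, ∀ f : (box d m → ℝ) →ᵇ ℝ,
    Tendsto (fun u : ℝ => ∫ ω, f (fun i => u⁻¹ * X ω i) ∂(P'[|{ω | u < |X ω 0|}])) atTop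
      (𝓝 (∫ ω, f (fun i => Y ω i) ∂P))

end TailField

/-! Both conditions are compared through the time-change formula `TimeChange`, which is equivalent
to exceedance-stationarity. Given the formula, split the event `θ_τ Y ∈ A` by the value of `τ` and
shift each piece; the shifted pieces partition `A` because exactly one exceedance-point is sent to
the origin by the bijection. Conversely, a set disjoint from its translate is tested by the
exceedance-map that swaps the two, and a general set splits into countably many such sets and a set
of fields fixed by the shift.

Necessity: for test functions vanishing where `|x_0| ≤ 1` the conditioning in the tail process can
be undone, so the limits concern `E[F(X/u)] / P(|X_0| > u)`. Stationarity of `X` then yields the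
time-change formula, and regular variation of `X_0` shows that the law of `Y` on `|Y_0| > y` is
`y^(-α)` times the law of `yY` (`IsTailProcess.restrict_exceeds`), which contains both the Pareto
law and the independence.

Sufficiency: `Y` determines a shift-invariant tail measure, homogeneous of order `-α`. On fields not
vanishing at the origin it is the image of `α r^(-α-1) dr` times the law of `Y/|Y_0|` under
multiplication; weights that sum to one glue its shifts into `blockMeasure` on each finite block.
The field `X` collects, at each site, the entry of largest modulus among the points of a Poisson
process with this intensity (entries of modulus at most `1` deleted), observed until an independent
exponential time. Its finite-dimensional laws are the unique solutions of the linear equation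
`IsCompound`, so consistency and stationarity are inherited from the tail measure, and no Poisson
process need be built. One large point dominates (`IsCompound.tendsto_sub`), so `X` has the
prescribed tail measure, whose restriction to `|x_0| > 1` is the law of `Y`. -/

namespace TailField

/-! ### Time-change formula and exceedance-stationarity -/

variable {d : ℕ}

@[fun_prop]
lemma measurable_shift (k : Fin d → ℤ) : Measurable (shift k : Field d → Field d) :=
  measurable_pi_lambda _ fun i => measurable_pi_apply (i + k)

@[simp]
lemma shift_apply (k i : Fin d → ℤ) (x : Field d) : shift k x i = x (i + k) := rfl

lemma shift_shift (j k : Fin d → ℤ) (x : Field d) : shift j (shift k x) = shift (j + k) x := by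
  funext i; simp [add_assoc]

@[simp]
lemma shift_zero (x : Field d) : shift 0 x = x := by funext i; simp

lemma measurableSet_exceeds (s : ℝ) (k : Fin d → ℤ) :
    MeasurableSet {x : Field d | s < |x k|} :=
  measurableSet_lt measurable_const (measurable_pi_apply k).abs

/-- The time-change formula: `E[h(θ_k Y); |Y_k| > 1] = E[h(Y); |Y_{-k}| > 1]`, for the law `Q`
of `Y`. -/
def TimeChange (Q : Measure (Field d)) : Prop :=
  ∀ k : Fin d → ℤ,
    (Q.restrict {x | 1 < |x k|}).map (shift k) = Q.restrict {x | 1 < |x (-k)|}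

lemma TimeChange.measure_eq {Q : Measure (Field d)} (hQ : TimeChange Q) (k : Fin d → ℤ)
    {A : Set (Field d)} (hA : MeasurableSet A) :
    Q ({x | 1 < |x k|} ∩ shift k ⁻¹' A) = Q ({x | 1 < |x (-k)|} ∩ A) := by
  have h := congrArg (fun μ => μ A) (hQ k)
  simp only [Measure.map_apply (measurable_shift k) hA, Measure.restrict_apply hA,
    Measure.restrict_apply (measurable_shift k hA)] at h
  rw [Set.inter_comm, h, Set.inter_comm]

/-- A map which is measurable on a measurable set agrees there with a measurable map. -/
lemma exists_measurable_extension {α β : Type*} [MeasurableSpace α] [MeasurableSpace β]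
    [Nonempty β] {B : Set α} (hB : MeasurableSet B) {f : α → β}
    (hf : Measurable (B.domRestrict f)) : ∃ g : α → β, Measurable g ∧ ∀ x ∈ B, g x = f x := by
  classical
  obtain ⟨b⟩ := ‹Nonempty β›
  refine ⟨fun x => if x ∈ B then f x else b, ?_, fun x hx => by simp [hx]⟩
  refine measurable_of_restrict_of_restrict_compl hB ?_ ?_
  · convert hf using 1
    funext x; simp [Set.domRestrict]
  · have : (Bᶜ).domRestrict (fun x => if x ∈ B then f x else b) = fun _ => b := by
      funext x; have := x.2; simp only [Set.mem_compl_iff] at this; simp [Set.domRestrict, this]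
    rw [this]; exact measurable_const

lemma measurable_shift_comp {τ : Field d → Fin d → ℤ} (hτ : Measurable τ) :
    Measurable fun x => shift (τ x) x := by
  have : Measurable fun p : (Fin d → ℤ) × Field d => shift p.1 p.2 :=
    measurable_from_prod_countable_right fun k => measurable_shift k
  exact this.comp (hτ.prodMk measurable_id)

/-- A mass-transport argument: the time-change formula moves each piece on which the exceedance-map
is constant, injectivity of the bijection keeps the moved pieces disjoint, and surjectivity makes
them cover the target. -/
lemma isExceedanceStationary_of_timeChange {Ω : Type*} [MeasurableSpace Ω] {P : Measure Ω}
    {Y : Ω → Field d} (hY : Measurable Y)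
    (hTC : TimeChange (P.map Y)) : IsExceedanceStationary P Y := by
  intro B τ hτ hYB
  obtain ⟨σ, hσ, hστ⟩ := exists_measurable_extension hτ.measurableSet hτ.measurable
  have hae : (fun ω => shift (σ (Y ω)) (Y ω)) =ᵐ[P] fun ω => shift (τ (Y ω)) (Y ω) := by
    filter_upwards [hYB] with ω hω
    rw [hστ _ hω]
  have hm := measurable_shift_comp hσ
  refine IdentDistrib.trans (IdentDistrib.of_ae_eq (hm.comp hY).aemeasurable hae).symm ?_
  refine ⟨(hm.comp hY).aemeasurable, hY.aemeasurable, ?_⟩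
  refine (Measure.map_map hm hY).symm.trans ?_
  set Q := P.map Y with hQ
  have hB : ∀ᵐ x ∂Q, x ∈ B := (ae_map_iff hY.aemeasurable hτ.measurableSet).2 hYB
  ext A hA
  rw [Measure.map_apply hm hA]
  let C : (Fin d → ℤ) → Set (Field d) := fun k => {x | x ∈ B ∧ σ x = k ∧ shift k x ∈ A}
  have hC : ∀ k, MeasurableSet (C k) := fun k =>
    hτ.measurableSet.inter ((hσ (measurableSet_singleton k)).inter (measurable_shift k hA))
  have hCk : ∀ k x, x ∈ C k → x ∈ {x : Field d | 1 < |x k|} := by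
    rintro k x ⟨hx, rfl, -⟩
    have := hτ.mem_exc x hx
    rw [← hστ x hx] at this
    exact this
  -- `D k` is the image of `C k` under the shift by `k`.
  let D : (Fin d → ℤ) → Set (Field d) := fun k =>
    {z | 1 < |z (-k)|} ∩ (shift (-k) ⁻¹' C k)
  have hD : ∀ k, MeasurableSet (D k) := fun k =>
    (measurableSet_exceeds 1 _).inter (measurable_shift _ (hC k))
  have hCD : ∀ k, Q (C k) = Q (D k) := by
    intro k
    rw [← hTC.measure_eq k (measurable_shift (-k) (hC k))]
    congr 1
    ext x
    simp only [Set.mem_inter_iff, Set.mem_preimage, shift_shift, neg_add_cancel, shift_zero]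
    exact ⟨fun hx => ⟨hCk k x hx, hx⟩, fun hx => hx.2⟩
  -- For `z ∈ A`, membership in `D k` singles out `-k` as the point that the bijection of `e(z)`
  -- sends to the origin.
  have key : ∀ z ∈ B, ∀ k, z ∈ D k ↔ (-k ∈ exc z ∧ -k + τ (shift (-k) z) = 0 ∧ z ∈ A) := by
    intro z hz k
    constructor
    · rintro ⟨h1, h2, h3, h4⟩
      refine ⟨h1, ?_, ?_⟩
      · rw [← hστ _ h2, h3]; simp
      · simpa [shift_shift] using h4
    · rintro ⟨h1, h2, h3⟩
      have hB' := hτ.shift_mem z hz _ h1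
      refine ⟨h1, hB', ?_, ?_⟩
      · rw [hστ _ hB']; exact (neg_add_eq_zero.1 h2).symm
      · simpa [shift_shift] using h3
  calc Q ((fun x => shift (σ x) x) ⁻¹' A) = Q (⋃ k, C k) := by
        refine measure_congr ?_
        filter_upwards [hB] with x hx
        apply propext
        change _ ∈ A ↔ x ∈ ⋃ k, C k
        simp only [Set.mem_iUnion]
        exact ⟨fun h => ⟨σ x, hx, rfl, h⟩, by rintro ⟨k, -, rfl, h⟩; exact h⟩
    _ = ∑' k, Q (C k) := by
        refine measure_iUnion (fun i j hij => Set.disjoint_left.2 ?_) hC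
        rintro x ⟨-, h1, -⟩ ⟨-, h2, -⟩
        exact hij (h1.symm.trans h2)
    _ = ∑' k, Q (D k) := by simp_rw [hCD]
    _ = Q (⋃ k, D k) := by
        refine (measure_iUnion₀ (fun i j hij => ?_) fun k => (hD k).nullMeasurableSet).symm
        refine measure_mono_null (t := Bᶜ) ?_ hB
        rintro z ⟨h1, h2⟩ hz
        obtain ⟨h1, h1', -⟩ := (key z hz i).1 h1
        obtain ⟨h2, h2', -⟩ := (key z hz j).1 h2
        exact hij (neg_injective ((hτ.bijOn z hz).injOn h1 h2 (h1'.trans h2'.symm)))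
    _ = Q A := by
        refine measure_congr ?_
        filter_upwards [hB] with z hz
        apply propext
        change z ∈ ⋃ k, D k ↔ z ∈ A
        simp only [Set.mem_iUnion]
        constructor
        · rintro ⟨k, hk⟩
          exact ((key z hz k).1 hk).2.2
        · intro h
          obtain ⟨j, hj, hj'⟩ := (hτ.bijOn z hz).surjOn (hτ.subset_R0 hz)
          refine ⟨-j, (key z hz _).2 ?_⟩
          rw [neg_neg]
          exact ⟨hj, hj', h⟩

/-- The exceedance-map that moves to `k` from `A`, moves back by `-k` to `A`, and rests elsewhere. -/
lemma isBijectiveExceedanceMap_swap (k : Fin d → ℤ) {A : Set (Field d)} (hA : MeasurableSet A)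
    (hA0 : ∀ x ∈ A, 1 < |x 0| ∧ 1 < |x k|) (hAk : ∀ x ∈ A, shift k x ∉ A) [DecidablePred (· ∈ A)] :
    IsBijectiveExceedanceMap (R0 d)
      (fun x => if x ∈ A then k else if shift (-k) x ∈ A then -k else 0) := by
  have hA' : ∀ x, shift (-k) x ∈ A → 1 < |x (-k)| := fun x hx => by
    have := (hA0 _ hx).1
    simpa using this
  set τ : Field d → Fin d → ℤ := fun x => if x ∈ A then k else if shift (-k) x ∈ A then -k else 0
    with hτ
  have hmaps : ∀ x, ∀ j ∈ exc x, j + τ (shift j x) ∈ exc x := by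
    intro x j hj
    simp only [hτ]
    split_ifs with h1 h2
    · have := (hA0 _ h1).2
      simpa [exc, add_comm] using this
    · have := hA' _ h2
      simpa [exc, add_comm] using this
    · simpa using hj
  -- The next displacement undoes the previous one, so `j ↦ j + τ (θ_j x)` is an involution of
  -- `e(x)`, hence a bijection.
  have hinv : ∀ x : Field d, ∀ j, τ (shift (j + τ (shift j x)) x) = - τ (shift j x) := by
    intro x j
    have e : ∀ y, shift (j + y) x = shift y (shift j x) := fun y => by rw [shift_shift, add_comm]
    rw [e]
    set z := shift j x
    simp only [hτ]
    by_cases h1 : z ∈ A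
    · have h2 := hAk z h1
      simp [h1, h2, shift_shift]
    · by_cases h2 : shift (-k) z ∈ A
      · simp [h1, h2]
      · simp [h1, h2]
  refine ⟨⟨measurableSet_exceeds 1 0, subset_rfl, ?_, ?_⟩, ?_, ?_⟩
  · have : Measurable τ := Measurable.ite hA measurable_const
      (Measurable.ite (measurable_shift _ hA) measurable_const measurable_const)
    exact this.comp measurable_subtype_coe
  · intro x hx
    have := hmaps x 0 hx
    simpa using this
  · intro x _ j hj
    have : 1 < |x j| := hj
    simpa [R0, exc] using this
  · intro x _
    refine Set.BijOn.mk (fun j hj => hmaps x j hj) ?_ ?_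
    · intro i _ j _ hij
      simp only at hij
      have h := hinv x i
      rw [hij, hinv x j, neg_inj] at h
      rwa [h, add_left_inj] at hij
    · intro j hj
      exact ⟨_, hmaps x j hj, by simp only [hinv]; abel⟩

/-- The swap lands in `A` exactly from the fields that it moves by `-k`: those starting in `A` leave
it, and the resting ones are outside `A`. -/
lemma measure_eq_of_isExceedanceStationary {Ω : Type*} [MeasurableSpace Ω] {P : Measure Ω}
    {Y : Ω → Field d} (hY : Measurable Y) (hY0 : ∀ ω, Y ω ∈ R0 d)
    (hES : IsExceedanceStationary P Y) (k : Fin d → ℤ) {A : Set (Field d)} (hA : MeasurableSet A)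
    (hA0 : ∀ x ∈ A, 1 < |x 0| ∧ 1 < |x k|) (hAk : ∀ x ∈ A, shift k x ∉ A) :
    P.map Y (shift (-k) ⁻¹' A) = P.map Y A := by
  classical
  have h := (hES _ _ (isBijectiveExceedanceMap_swap k hA hA0 hAk) (ae_of_all _ hY0)).map_eq
  have hτ : Measurable fun x : Field d =>
      if x ∈ A then k else if shift (-k) x ∈ A then -k else 0 :=
    Measurable.ite hA measurable_const
      (Measurable.ite (measurable_shift _ hA) measurable_const measurable_const)
  have h2 := congrArg (fun μ => μ A) h
  have hm : Measurable fun ω => shift (if Y ω ∈ A then k else if shift (-k) (Y ω) ∈ A then -k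
      else 0) (Y ω) := (measurable_shift_comp hτ).comp hY
  rw [Measure.map_apply hm hA] at h2
  rw [← h2, Measure.map_apply hY (measurable_shift _ hA)]
  congr 1
  ext ω
  simp only [Set.mem_preimage]
  split_ifs with h1 h3
  · simp only [hAk _ h1, iff_false]
    intro h3
    exact hAk _ h3 (by simpa [shift_shift] using h1)
  · rfl
  · simp [h1, h3]

/-- The swap needs a set disjoint from its translate. Periodic fields can never be arranged so, but
they form a set that the shift preserves and need no argument; the rest splits into countably many
admissible pieces. -/
lemma timeChange_of_isExceedanceStationary {Ω : Type*} [MeasurableSpace Ω] {P : Measure Ω}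
    {Y : Ω → Field d} (hY : Measurable Y) (hY0 : ∀ ω, Y ω ∈ R0 d)
    (hES : IsExceedanceStationary P Y) : TimeChange (P.map Y) := by
  intro k
  set Q := P.map Y with hQ
  have hQ0 : ∀ᵐ x ∂Q, 1 < |x 0| :=
    (ae_map_iff hY.aemeasurable (measurableSet_exceeds 1 0)).2 (ae_of_all _ hY0)
  -- it suffices to treat sets of fields on which the two origins are exceedance-points
  suffices H : ∀ A : Set (Field d), MeasurableSet A → (∀ x ∈ A, 1 < |x 0| ∧ 1 < |x k|) →
      Q (shift (-k) ⁻¹' A) = Q A by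
    ext A hA
    rw [Measure.map_apply (measurable_shift k) hA, Measure.restrict_apply hA,
      Measure.restrict_apply (measurable_shift k hA)]
    have h := H (shift k ⁻¹' A ∩ {x | 1 < |x k|} ∩ {x | 1 < |x 0|})
      (((measurable_shift k hA).inter (measurableSet_exceeds 1 k)).inter
        (measurableSet_exceeds 1 0)) (fun x hx => ⟨hx.2, hx.1.2⟩)
    calc Q (shift k ⁻¹' A ∩ {x | 1 < |x k|})
        = Q (shift k ⁻¹' A ∩ {x | 1 < |x k|} ∩ {x | 1 < |x 0|}) := by
          refine measure_congr ?_
          filter_upwards [hQ0] with x hx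
          exact propext ⟨fun h => ⟨h, hx⟩, fun h => h.1⟩
      _ = Q _ := h.symm
      _ = Q (A ∩ {x | 1 < |x (-k)|}) := by
          refine measure_congr ?_
          filter_upwards [hQ0] with x hx
          apply propext
          change (_ ∧ _) ↔ (_ ∧ _)
          simp [shift_shift, hx]
  intro A hA hA0
  -- a countable family that separates points
  obtain ⟨D, hDm, hDsep⟩ : ∃ D : ℕ → Set (Field d), (∀ n, MeasurableSet (D n)) ∧
      ∀ x y : Field d, x ≠ y → ∃ n, x ∈ D n ∧ y ∉ D n := by
    obtain ⟨S, hS, hS'⟩ := exists_seq_separating (Field d) (p := MeasurableSet)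
      MeasurableSet.empty Set.univ
    -- The Boolean chooses between a separating set and its complement, so that every ordered pair
    -- `x ≠ y` has some `D n` containing `x` and not `y`.
    obtain ⟨e, he⟩ := exists_surjective_nat (ℕ × Bool)
    refine ⟨fun n => if (e n).2 then S (e n).1 else (S (e n).1)ᶜ, fun n => ?_, fun x y hxy => ?_⟩
    · dsimp only
      split_ifs
      exacts [hS _, (hS _).compl]
    · by_contra! h
      refine hxy (hS' x trivial y trivial fun n => ?_)
      obtain ⟨m, hm⟩ := he (n, true)
      obtain ⟨m', hm'⟩ := he (n, false)
      have h1 := h m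
      have h2 := h m'
      simp only [hm, hm', if_true, Bool.false_eq_true, if_false, Set.mem_compl_iff] at h1 h2
      exact ⟨h1, fun hy => by_contra fun hx => h2 hx hy⟩
  -- On `C n` the field lies in `D n` and its shift does not, so `θ_k` moves `C n` off itself.
  let C : ℕ → Set (Field d) := fun n => A ∩ (D n ∩ shift k ⁻¹' (D n)ᶜ)
  have hC : ∀ n, MeasurableSet (C n) := fun n =>
    hA.inter ((hDm n).inter (measurable_shift k (hDm n).compl))
  let F : Set (Field d) := A ∩ {x | shift k x = x}
  have hF : MeasurableSet F := hA.inter (measurableSet_eq_fun (measurable_shift k) measurable_id)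
  have hAun : A = F ∪ ⋃ n, disjointed C n := by
    rw [iUnion_disjointed, ← Set.inter_iUnion, ← Set.inter_union_distrib_left]
    symm
    rw [Set.inter_eq_left]
    intro x _
    by_cases hx : shift k x = x
    · exact Or.inl hx
    · obtain ⟨n, h1, h2⟩ := hDsep x (shift k x) (Ne.symm hx)
      exact Or.inr (Set.mem_iUnion.2 ⟨n, h1, h2⟩)
  have hdm : ∀ n, MeasurableSet (disjointed C n) := fun n => MeasurableSet.disjointed hC n
  have hFdisj : Disjoint F (⋃ n, disjointed C n) := by
    rw [iUnion_disjointed, Set.disjoint_left]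
    intro x hx hx'
    obtain ⟨n, -, h1, h2⟩ := Set.mem_iUnion.1 hx'
    have h3 : shift k x = x := hx.2
    exact h2 (by rw [h3]; exact h1)
  have hsF : shift (-k) ⁻¹' F = F := by
    ext x
    have h1 : shift k x = x → shift (-k) x = x := fun h => by
      conv_lhs => rw [← h]
      simp [shift_shift]
    constructor
    · rintro ⟨hx, hx'⟩
      have h2 : shift (-k) x = x := by
        have h3 : shift k (shift (-k) x) = shift (-k) x := hx'
        rw [← h3]; simp [shift_shift]
      rw [h2] at hx hx'
      exact ⟨hx, hx'⟩
    · rintro ⟨hx, hx'⟩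
      rw [Set.mem_preimage, h1 hx']
      exact ⟨hx, hx'⟩
  have hpre : shift (-k) ⁻¹' A = F ∪ ⋃ n, shift (-k) ⁻¹' disjointed C n := by
    conv_lhs => rw [hAun]
    rw [Set.preimage_union, hsF, Set.preimage_iUnion]
  rw [hpre, measure_union _ (MeasurableSet.iUnion fun n => measurable_shift _ (hdm n)),
    measure_iUnion _ (fun n => measurable_shift _ (hdm n))]
  · conv_rhs => rw [hAun, measure_union hFdisj (MeasurableSet.iUnion hdm),
      measure_iUnion (disjoint_disjointed C) hdm]
    congr 1
    refine tsum_congr fun n => ?_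
    refine measure_eq_of_isExceedanceStationary hY hY0 hES k (hdm n)
      (fun x hx => hA0 x (disjointed_subset C n hx).1) fun x hx hx' => ?_
    exact (disjointed_subset C n hx).2.2 (disjointed_subset C n hx').2.1
  · intro i j hij
    exact (disjoint_disjointed C hij).preimage _
  · rw [← Set.preimage_iUnion, ← hsF]
    exact hFdisj.preimage _


/-! ### Continuous test functions for open exceedance events -/

/-- The piecewise linear function which is `0` on `(-∞, 1]` and `1` on `[1 + 1/n, ∞)`. -/
noncomputable def ramp (n : ℕ) (t : ℝ) : ℝ := max 0 (min 1 (n * (t - 1)))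

@[fun_prop]
lemma continuous_ramp (n : ℕ) : Continuous (ramp n) := by unfold ramp; fun_prop

lemma ramp_nonneg (n : ℕ) (t : ℝ) : 0 ≤ ramp n t := le_max_left _ _

lemma ramp_le_one (n : ℕ) (t : ℝ) : ramp n t ≤ 1 := max_le zero_le_one (min_le_left _ _)

lemma abs_ramp_le (n : ℕ) (t : ℝ) : |ramp n t| ≤ 1 := by
  rw [abs_of_nonneg (ramp_nonneg n t)]; exact ramp_le_one n t

lemma ramp_of_le {n : ℕ} {t : ℝ} (ht : t ≤ 1) : ramp n t = 0 :=
  max_eq_left ((min_le_right _ _).trans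
    (mul_nonpos_of_nonneg_of_nonpos n.cast_nonneg (sub_nonpos.2 ht)))

lemma ramp_of_ge {n : ℕ} {t : ℝ} (ht : 1 ≤ n * (t - 1)) : ramp n t = 1 := by
  simp [ramp, min_eq_left ht]

lemma tendsto_ramp (t : ℝ) :
    Tendsto (fun n => ramp n t) atTop (𝓝 (Set.indicator (Set.Ioi 1) 1 t)) := by
  by_cases ht : t ≤ 1
  · simp [ramp_of_le ht, ht]
  · push Not at ht
    rw [Set.indicator_of_mem (Set.mem_Ioi.2 ht)]
    obtain ⟨N, hN⟩ := exists_nat_ge (1 / (t - 1))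
    refine tendsto_const_nhds.congr' ?_
    filter_upwards [eventually_ge_atTop N] with n hn
    refine (ramp_of_ge ?_).symm
    have h : (N : ℝ) ≤ n := by exact_mod_cast hn
    exact (div_le_iff₀ (sub_pos.2 ht)).1 (hN.trans h)

/-- Recovers integrals over `{a > 1}` from continuous test functions, without knowing that the limit
law gives no mass to the boundary `{a = 1}`. -/
lemma tendsto_integral_ramp {E : Type*} [MeasurableSpace E] {μ : Measure E} [IsFiniteMeasure μ]
    {F a : E → ℝ} (hF : Measurable F) {C : ℝ} (hC : ∀ x, |F x| ≤ C) (ha : Measurable a) :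
    Tendsto (fun n : ℕ => ∫ x, F x * ramp n (a x) ∂μ) atTop
      (𝓝 (∫ x in {x | 1 < a x}, F x ∂μ)) := by
  rw [← integral_indicator (measurableSet_lt measurable_const ha)]
  refine tendsto_integral_of_dominated_convergence (fun _ => C) (fun n => ?_)
    (integrable_const C) (fun n => ae_of_all _ fun x => ?_) (ae_of_all _ fun x => ?_)
  · exact (hF.mul ((continuous_ramp n).measurable.comp ha)).aestronglyMeasurable
  · rw [Real.norm_eq_abs, abs_mul]
    calc |F x| * |ramp n (a x)| ≤ |F x| * 1 :=
          mul_le_mul_of_nonneg_left (abs_ramp_le _ _) (abs_nonneg _)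
      _ ≤ C := by rw [mul_one]; exact hC x
  · have := (tendsto_ramp (a x)).const_mul (F x)
    convert this using 2
    by_cases h : 1 < a x <;> simp [Set.indicator, h]

/-- Bounded continuous functions of finitely many coordinates. -/
structure IsLocalTest (F : Field d → ℝ) : Prop where
  cont : Continuous F
  bdd : ∃ C, ∀ x, |F x| ≤ C
  loc : ∃ m : ℕ, ∀ x y : Field d, (∀ i ∈ box d m, x i = y i) → F x = F y

lemma mem_box {m : ℕ} {i : Fin d → ℤ} : i ∈ box d m ↔ ∀ j, |i j| ≤ m := by
  simp [box, Pi.le_def, abs_le, forall_and]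

lemma box_mono {m n : ℕ} (h : m ≤ n) : box d m ⊆ box d n := fun i hi => by
  rw [mem_box] at hi ⊢
  exact fun j => (hi j).trans (by exact_mod_cast h)

lemma zero_mem_box (m : ℕ) : (0 : Fin d → ℤ) ∈ box d m := by simp [mem_box]

lemma exists_subset_box (I : Finset (Fin d → ℤ)) : ∃ m, I ⊆ box d m := by
  refine ⟨I.sup fun i => Finset.univ.sup fun j => (i j).natAbs, fun i hi => mem_box.2 fun j => ?_⟩
  have h1 : (i j).natAbs ≤ Finset.univ.sup fun j => (i j).natAbs :=
    Finset.le_sup (f := fun j => (i j).natAbs) (Finset.mem_univ j)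
  have h2 := Finset.le_sup (f := fun i : Fin d → ℤ => Finset.univ.sup fun j => (i j).natAbs) hi
  rw [Int.abs_eq_natAbs]
  exact_mod_cast h1.trans h2

lemma IsLocalTest.mul {F G : Field d → ℝ} (hF : IsLocalTest F) (hG : IsLocalTest G) :
    IsLocalTest fun x => F x * G x := by
  obtain ⟨hFc, ⟨C, hC⟩, m, hm⟩ := hF
  obtain ⟨hGc, ⟨D, hD⟩, n, hn⟩ := hG
  refine ⟨hFc.mul hGc, ⟨C * D, fun x => ?_⟩, max m n, fun x y h => ?_⟩
  · rw [abs_mul]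
    exact mul_le_mul (hC x) (hD x) (abs_nonneg _) ((abs_nonneg _).trans (hC x))
  · rw [hm x y fun i hi => h i (box_mono (le_max_left _ _) hi),
      hn x y fun i hi => h i (box_mono (le_max_right _ _) hi)]

lemma IsLocalTest.comp_coord {F : Field d → ℝ} (hF : IsLocalTest F) (k : Fin d → ℤ) (c : ℝ) :
    IsLocalTest fun x => F (c • shift k x) := by
  obtain ⟨hFc, ⟨C, hC⟩, m, hm⟩ := hF
  obtain ⟨n, hn⟩ := exists_subset_box ((box d m).image (· + k))
  refine ⟨hFc.comp ?_, ⟨C, fun x => hC _⟩, n, fun x y h => hm _ _ fun i hi => ?_⟩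
  · unfold shift; fun_prop
  · simp [h _ (hn (Finset.mem_image_of_mem _ hi))]

lemma isLocalTest_ramp (n : ℕ) (k l : Fin d → ℤ) (c : ℝ) :
    IsLocalTest fun x => ramp n (min |x k| |x l| / c) := by
  obtain ⟨m, hm⟩ := exists_subset_box {k, l}
  refine ⟨by fun_prop, ⟨1, fun x => abs_ramp_le _ _⟩, m, fun x y h => ?_⟩
  rw [h k (hm (by simp)), h l (hm (by simp))]

/-- A finite measure is the projective limit of its marginals, and these are determined by bounded
continuous functions. -/
lemma ext_of_forall_isLocalTest {μ ν : Measure (Field d)} [IsFiniteMeasure μ] [IsFiniteMeasure ν]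
    (h : ∀ F : Field d → ℝ, IsLocalTest F → ∫ x, F x ∂μ = ∫ x, F x ∂ν) : μ = ν := by
  refine IsProjectiveLimit.unique (P := fun I => ν.map I.restrict) (fun I => ?_) fun I => rfl
  refine ext_of_forall_integral_eq_of_IsFiniteMeasure fun f => ?_
  rw [integral_map (by fun_prop) (by fun_prop), integral_map (by fun_prop) (by fun_prop)]
  obtain ⟨m, hm⟩ := exists_subset_box I
  refine h _ ⟨by fun_prop, ⟨‖f‖, fun x => f.norm_coe_le_norm _⟩, m, fun x y hxy => ?_⟩
  congr 1
  funext i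
  exact hxy i (hm i.2)

/-! ### Necessity: properties of a tail process -/

section Necessity

variable {Ω Ω' : Type*} [MeasurableSpace Ω] [MeasurableSpace Ω'] {P : Measure Ω} {P' : Measure Ω'}
  {X : Ω' → Field d} {Y : Ω → Field d}

/-- If `F` vanishes where `|x_0| ≤ 1`, then `F(X/u)` vanishes off `{|X_0| > u}`. The expectation
becomes unconditional, which lets stationarity act on it. -/
lemma IsTailProcess.tendsto_integral (h : IsTailProcess P' X P Y) (hY : Measurable Y) {F : Field d → ℝ} (hF : IsLocalTest F)
    (hF0 : ∀ x : Field d, |x 0| ≤ 1 → F x = 0) :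
    Tendsto (fun u : ℝ => (∫ ω, F (u⁻¹ • X ω) ∂P') / P'.real {ω | u < |X ω 0|}) atTop
      (𝓝 (∫ x, F x ∂(P.map Y))) := by
  classical
  obtain ⟨hFc, ⟨C, hC⟩, m, hm⟩ := hF
  -- Padding by `0` outside the box is harmless because `F` reads only the box.
  let ext : (box d m → ℝ) → Field d := fun v i => if hi : i ∈ box d m then v ⟨i, hi⟩ else 0
  have hext : Continuous ext := continuous_pi fun i => by
    by_cases hi : i ∈ box d m
    · simpa [ext, hi] using continuous_apply _
    · simpa [ext, hi] using continuous_const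
  let f : (box d m → ℝ) →ᵇ ℝ := BoundedContinuousFunction.ofNormedAddCommGroup (F ∘ ext)
    (hFc.comp hext) C fun v => hC _
  have hf : ∀ x : Field d, f (fun i => x i) = F x := fun x =>
    hm _ _ fun i hi => by simp [ext, hi]
  have h1 := h.tendsto m f
  have e1 : ∫ ω, f (fun i => Y ω i) ∂P = ∫ x, F x ∂(P.map Y) := by
    rw [integral_map hY.aemeasurable hFc.aestronglyMeasurable]
    simp_rw [hf]
  rw [e1] at h1
  refine h1.congr' ?_
  filter_upwards [eventually_gt_atTop 0] with u hu
  have e2 : ∀ ω, f (fun i : box d m => u⁻¹ * X ω i) = F (u⁻¹ • X ω) := fun ω => hf (u⁻¹ • X ω)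
  simp_rw [e2]
  rw [ProbabilityTheory.cond, integral_smul_measure, ENNReal.toReal_inv, smul_eq_mul, inv_mul_eq_div,
    ← measureReal_def]
  congr 1
  refine setIntegral_eq_integral_of_forall_compl_eq_zero fun ω hω => hF0 _ ?_
  simp only [Set.mem_ofPred_eq, not_lt] at hω
  rw [Pi.smul_apply, smul_eq_mul, abs_mul, abs_of_pos (inv_pos.2 hu), inv_mul_le_iff₀ hu, mul_one]
  exact hω

variable [IsProbabilityMeasure P]

/-- The two sides of `key` are limits of equal quantities: the first test function is the second one
composed with `θ_k`. The minimum with `|x_0|` makes both vanish where `|x_0| ≤ 1`. -/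
lemma IsTailProcess.timeChange (h : IsTailProcess P' X P Y) (hY : Measurable Y) (hst : IsStationary P' X) : TimeChange (P.map Y) := by
  intro k
  set Q := P.map Y with hQ
  have : IsProbabilityMeasure Q := Measure.isProbabilityMeasure_map hY.aemeasurable
  have hQ0 : ∀ᵐ x ∂Q, 1 < |x 0| :=
    (ae_map_iff hY.aemeasurable (measurableSet_exceeds 1 0)).2 h.exceeds
  refine ext_of_forall_isLocalTest fun F hF => ?_
  rw [integral_map (by fun_prop) hF.cont.aestronglyMeasurable]
  have key : ∀ n : ℕ, ∫ x, F (shift k x) * ramp n (min |x k| |x 0|) ∂Q =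
      ∫ x, F x * ramp n (min |x 0| |x (-k)|) ∂Q := by
    intro n
    have hF1 : IsLocalTest fun x => F (shift k x) * ramp n (min |x k| |x 0|) := by
      simpa using (hF.comp_coord k 1).mul (isLocalTest_ramp n k 0 1)
    have hF2 : IsLocalTest fun x => F x * ramp n (min |x 0| |x (-k)|) := by
      simpa using hF.mul (isLocalTest_ramp n 0 (-k) 1)
    refine tendsto_nhds_unique (h.tendsto_integral hY hF1 fun x hx => ?_)
      ((h.tendsto_integral hY hF2 fun x hx => ?_).congr fun u => ?_)
    · rw [ramp_of_le ((min_le_right _ _).trans hx), mul_zero]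
    · rw [ramp_of_le ((min_le_left _ _).trans hx), mul_zero]
    · congr 1
      have h2 : Measurable fun x : Field d => F (u⁻¹ • x) *
          ramp n (min |(u⁻¹ • x) 0| |(u⁻¹ • x) (-k)|) :=
        (hF2.cont.comp (continuous_const_smul u⁻¹)).measurable
      have h3 := ((hst k).comp h2).integral_eq
      simp only [Function.comp_def] at h3
      rw [← h3]
      refine integral_congr_ae (ae_of_all _ fun ω => ?_)
      have e : shift k (u⁻¹ • X ω) = u⁻¹ • shift k (X ω) := rfl
      simp [e]
  obtain ⟨C, hC⟩ := hF.bdd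
  have l1 := tendsto_integral_ramp (μ := Q) (F := fun x => F (shift k x))
    (a := fun x => min |x k| |x 0|) (hF.cont.measurable.comp (measurable_shift k))
    (fun x => hC _) (by fun_prop)
  have l2 := tendsto_integral_ramp (μ := Q) (F := F)
    (a := fun x => min |x 0| |x (-k)|) hF.cont.measurable hC (by fun_prop)
  simp_rw [key] at l1
  have := tendsto_nhds_unique l1 l2
  convert this using 1
  · congr 1
    refine Measure.restrict_congr_set ?_
    filter_upwards [hQ0] with x hx
    apply propext
    change _ < _ ↔ _ < _
    simp [hx]
  · congr 1
    refine Measure.restrict_congr_set ?_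
    filter_upwards [hQ0] with x hx
    apply propext
    change _ < _ ↔ _ < _
    simp [hx]

variable [IsProbabilityMeasure P']

/-- The variable `f(V/(uy))` has two normalizations, by the tail at `u` and at `uy`. Their limits
are `y^(-α) ∫ f dμ` and `∫ f dμ`, and the quotient leaves the tail ratio. A continuous `f` spares
any discussion of spheres charged by `μ`. -/
lemma IsRegularlyVaryingVector.tendsto_tail_ratio {I : Type*} [Fintype I] {V : Ω' → I → ℝ} {α : ℝ}
    (h : IsRegularlyVaryingVector P' V α) {y : ℝ} (hy : 0 < y) :
    Tendsto (fun u : ℝ => P'.real {ω | u * y < ‖V ω‖} / P'.real {ω | u < ‖V ω‖}) atTop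
      (𝓝 (y ^ (-α))) := by
  obtain ⟨hpos, μ, hμ, hμ0, hfin, hhom, hlim⟩ := h
  -- a level below which the limit measure does not have all of its mass
  obtain ⟨ε, hε, hμε⟩ : ∃ ε : ℝ, 0 < ε ∧ μ {x | ε ≤ ‖x‖} ≠ 0 := by
    by_contra! hc
    refine hμ (Measure.measure_univ_eq_zero.1 ?_)
    have : (Set.univ : Set (I → ℝ)) = {0} ∪ ⋃ n : ℕ, {x | 1 / ((n : ℝ) + 1) ≤ ‖x‖} := by
      symm
      rw [Set.eq_univ_iff_forall]
      intro x
      by_cases hx : x = 0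
      · exact Or.inl hx
      · obtain ⟨n, hn⟩ := exists_nat_one_div_lt (norm_pos_iff.2 hx)
        exact Or.inr (Set.mem_iUnion.2 ⟨n, hn.le⟩)
    rw [this, measure_union_null_iff, measure_iUnion_null_iff]
    exact ⟨hμ0, fun n => hc _ (by positivity)⟩
  -- This function is `0` for `‖x‖ ≤ ε/2` and `1` for `‖x‖ ≥ ε`, so it is an admissible test
  -- function with positive integral.
  have hfc : Continuous fun x : I → ℝ => ramp 1 (2 * ‖x‖ / ε) := by fun_prop
  let f : (I → ℝ) →ᵇ ℝ := BoundedContinuousFunction.ofNormedAddCommGroup _ hfc 1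
    fun x => abs_ramp_le _ _
  have hf : ∀ x, f x = ramp 1 (2 * ‖x‖ / ε) := fun x => rfl
  let g : (I → ℝ) →ᵇ ℝ := f.compContinuous ⟨fun x => y⁻¹ • x, by fun_prop⟩
  have hg : ∀ x, g x = f (y⁻¹ • x) := fun x => rfl
  have hf0 : ∀ x, ‖x‖ < ε / 2 → f x = 0 := fun x hx => by
    rw [hf, ramp_of_le]
    rw [div_le_one hε]; linarith
  have hfI : Integrable f μ := by
    have : IntegrableOn f {x | ε / 2 ≤ ‖x‖} μ := by
      refine Measure.integrableOn_of_bounded (M := 1) (hfin _ (by positivity)).ne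
        f.continuous.aestronglyMeasurable (ae_of_all _ fun x => abs_ramp_le _ _)
    refine (integrableOn_iff_integrable_of_support_subset fun x hx => ?_).1 this
    by_contra hc
    exact hx (hf0 x (not_le.1 hc))
  have hfpos : 0 < ∫ x, f x ∂μ := by
    have h1 : ∫ x in {x | ε ≤ ‖x‖}, f x ∂μ = μ.real {x | ε ≤ ‖x‖} := by
      rw [setIntegral_congr_fun (g := fun _ => (1 : ℝ))
        (measurableSet_le measurable_const measurable_norm)]
      · simp
      · intro x hx
        rw [hf, ramp_of_ge]
        simp only [Set.mem_ofPred_eq] at hx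
        have : 2 ≤ 2 * ‖x‖ / ε := by rw [le_div_iff₀ hε]; linarith
        simpa using by linarith
    have h2 := setIntegral_le_integral (s := {x | ε ≤ ‖x‖}) hfI
      (ae_of_all _ fun x => ramp_nonneg _ _)
    rw [h1] at h2
    exact (ENNReal.toReal_pos hμε (hfin ε hε).ne).trans_le h2
  have hgint : ∫ x, g x ∂μ = y ^ (-α) * ∫ x, f x ∂μ := by
    have hmap : μ.map (fun x => y⁻¹ • x) = ENNReal.ofReal (y ^ (-α)) • μ := by
      ext A hA
      rw [Measure.map_apply (by fun_prop) hA, Measure.smul_apply, smul_eq_mul,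
        Real.rpow_neg hy.le, ← Real.inv_rpow hy.le]
      exact hhom _ (inv_pos.2 hy) A hA
    simp_rw [hg]
    rw [← integral_map (φ := fun x => y⁻¹ • x) (by fun_prop) f.continuous.aestronglyMeasurable,
      hmap, integral_smul_measure, ENNReal.toReal_ofReal (Real.rpow_nonneg hy.le _), smul_eq_mul]
  have hyu : Tendsto (fun u : ℝ => u * y) atTop atTop := tendsto_id.atTop_mul_const hy
  have l1 := (hlim f ⟨ε / 2, by positivity, hf0⟩).comp hyu
  have l2 := hlim g ⟨y * (ε / 2), by positivity, fun x hx => hf0 _ (by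
    change ‖y⁻¹ • x‖ < _
    rwa [norm_smul, norm_inv, Real.norm_of_nonneg hy.le, inv_mul_lt_iff₀ hy])⟩
  have l3 := l2.div l1 hfpos.ne'
  rw [hgint, mul_div_cancel_right₀ _ hfpos.ne'] at l3
  refine l3.congr' ?_
  have hev := l1.eventually_ne hfpos.ne'
  filter_upwards [hev] with u hu
  simp only [Function.comp_def] at hu
  simp only [Function.comp_def, hg, Pi.div_apply]
  have e : ∀ ω, y⁻¹ • u⁻¹ • V ω = (u * y)⁻¹ • V ω := fun ω => by rw [smul_smul, mul_inv, mul_comm]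
  simp_rw [e]
  have hn : (∫ ω, f ((u * y)⁻¹ • V ω) ∂P') ≠ 0 := fun h0 => hu (by rw [h0, zero_div])
  have hd := (ENNReal.toReal_pos (hpos (u * y)).ne' (measure_ne_top _ _)).ne'
  have hd' := (ENNReal.toReal_pos (hpos u).ne' (measure_ne_top _ _)).ne'
  rw [← measureReal_def] at hd hd'
  rw [div_div_div_eq, mul_comm (P'.real _), mul_div_mul_left _ _ hn]

/-- Exceeding `uy` is exceeding `u` at a rescaled level: the expectation normalized at `u` is the
tail ratio, tending to `y^(-α)`, times the same expectation normalized at `uy`. Radius and shape of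
`Y` are both read off from this identity. -/
lemma IsTailProcess.restrict_exceeds (h : IsTailProcess P' X P Y) (hY : Measurable Y) {α : ℝ} (hRV : IsRegularlyVaryingField P' X α) {y : ℝ} (hy : 1 ≤ y) :
    (P.map Y).restrict {x | y < |x 0|} =
      ENNReal.ofReal (y ^ (-α)) • (P.map Y).map (fun x => y • x) := by
  have hy0 : 0 < y := zero_lt_one.trans_le hy
  set Q := P.map Y with hQ
  have : IsProbabilityMeasure Q := Measure.isProbabilityMeasure_map hY.aemeasurable
  have hQ0 : ∀ᵐ x ∂Q, 1 < |x 0| :=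
    (ae_map_iff hY.aemeasurable (measurableSet_exceeds 1 0)).2 h.exceeds
  have : IsFiniteMeasure (ENNReal.ofReal (y ^ (-α)) • Q.map (fun x => y • x)) :=
    Measure.smul_finite _ ENNReal.ofReal_ne_top
  have hratio := (hRV {0} (Finset.singleton_nonempty 0)).tendsto_tail_ratio hy0
  have hnorm : ∀ ω, ‖fun i : ({0} : Finset (Fin d → ℤ)) => X ω i‖ = |X ω 0| := fun ω => by
    refine le_antisymm ((pi_norm_le_iff_of_nonneg (abs_nonneg _)).2 fun i => ?_) ?_
    · rw [Finset.mem_singleton.1 i.2]; rfl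
    · exact norm_le_pi_norm (fun i : ({0} : Finset (Fin d → ℤ)) => X ω i)
        ⟨0, Finset.mem_singleton_self 0⟩
  simp_rw [hnorm] at hratio
  refine ext_of_forall_isLocalTest fun F hF => ?_
  rw [integral_smul_measure, integral_map (by fun_prop) hF.cont.aestronglyMeasurable,
    ENNReal.toReal_ofReal (by positivity), smul_eq_mul]
  have key : ∀ n : ℕ, ∫ x, F x * ramp n (|x 0| / y) ∂Q =
      y ^ (-α) * ∫ x, F (y • x) * ramp n |x 0| ∂Q := by
    intro n
    have hF1 : IsLocalTest fun x => F x * ramp n (|x 0| / y) := by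
      simpa using hF.mul (isLocalTest_ramp n 0 0 y)
    have hF2 : IsLocalTest fun x => F (y • x) * ramp n |x 0| := by
      simpa using (hF.comp_coord 0 y).mul (isLocalTest_ramp n 0 0 1)
    have hyu : Tendsto (fun u : ℝ => u * y) atTop atTop := tendsto_id.atTop_mul_const hy0
    refine tendsto_nhds_unique (h.tendsto_integral hY hF1 fun x hx => ?_)
      ((hratio.mul ((h.tendsto_integral hY hF2 fun x hx => ?_).comp hyu)).congr fun u => ?_)
    · rw [ramp_of_le, mul_zero]
      rw [div_le_one hy0]; exact hx.trans hy
    · rw [ramp_of_le hx, mul_zero]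
    · have hd := (ENNReal.toReal_pos (h.pos (u * y)).ne' (measure_ne_top _ _)).ne'
      rw [← measureReal_def] at hd
      simp only [Function.comp_def]
      rw [div_mul_div_comm, mul_comm, mul_div_mul_right _ _ hd]
      congr 1
      refine integral_congr_ae (ae_of_all _ fun ω => ?_)
      have e1 : y • (u * y)⁻¹ • X ω = u⁻¹ • X ω := by
        rw [smul_smul]; congr 1; field_simp
      simp only [e1]
      congr 2
      simp only [Pi.smul_apply, smul_eq_mul, abs_mul, mul_inv, abs_inv, abs_of_pos hy0]
      field_simp
  obtain ⟨C, hC⟩ := hF.bdd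
  have l1 := tendsto_integral_ramp (μ := Q) (F := F)
    (a := fun x => |x 0| / y) hF.cont.measurable hC (by fun_prop)
  have l2 := (tendsto_integral_ramp (μ := Q) (F := fun x => F (y • x))
    (a := fun x => |x 0|) (hF.cont.measurable.comp (measurable_const_smul y))
    (fun x => hC _) (by fun_prop)).const_mul (y ^ (-α))
  simp_rw [key] at l1
  have := tendsto_nhds_unique l1 l2
  simp_rw [one_lt_div hy0] at this
  rw [this]
  congr 2
  rw [Measure.restrict_eq_self_of_ae_mem]
  exact hQ0

lemma paretoMeasure_Ioi {α y : ℝ} (hα : 0 < α) (hy : 1 ≤ y) :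
    paretoMeasure 1 α (Set.Ioi y) = ENNReal.ofReal (y ^ (-α)) := by
  have hy0 : 0 < y := zero_lt_one.trans_le hy
  rw [paretoMeasure, withDensity_apply _ measurableSet_Ioi]
  rw [setLIntegral_congr_fun (g := fun x => ENNReal.ofReal (α * x ^ (-(α + 1)))) measurableSet_Ioi
    fun x hx => by
      rw [paretoPDF_of_le (hy.trans (le_of_lt hx)), Real.one_rpow, mul_one]]
  rw [← ofReal_integral_eq_lintegral_ofReal]
  · rw [integral_const_mul, integral_Ioi_rpow_of_lt (by linarith) hy0]
    congr 1
    have : -(α + 1) + 1 = -α := by ring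
    rw [this]; field_simp
  · exact (integrableOn_Ioi_rpow_of_lt (by linarith) hy0).const_mul _
  · filter_upwards [ae_restrict_mem measurableSet_Ioi] with x hx
    have : 0 < x := hy0.trans hx
    positivity

lemma paretoMeasure_Ioi_of_le {α y : ℝ} (hα : 0 < α) (hy : y ≤ 1) :
    paretoMeasure 1 α (Set.Ioi y) = 1 := by
  have := isProbabilityMeasure_paretoMeasure zero_lt_one hα
  refine le_antisymm prob_le_one ?_
  calc (1 : ℝ≥0∞) = paretoMeasure 1 α (Set.Ioi 1) := by
        rw [paretoMeasure_Ioi hα le_rfl]; simp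
    _ ≤ _ := measure_mono (Set.Ioi_subset_Ioi hy)

/-- Normalized fields are unchanged by scaling, so `restrict_exceeds` factorizes on events about
`Y/|Y_0|`. For `y ≤ 1` the radial condition is almost sure. -/
lemma IsTailProcess.measure_polar (h : IsTailProcess P' X P Y) (hY : Measurable Y) {α : ℝ} (hα : 0 < α) (hRV : IsRegularlyVaryingField P' X α) (y : ℝ)
    {A : Set (Field d)} (hA : MeasurableSet A) :
    P ({ω | y < |Y ω 0|} ∩ (fun ω i => Y ω i / |Y ω 0|) ⁻¹' A) =
      paretoMeasure 1 α (Set.Ioi y) * P ((fun ω i => Y ω i / |Y ω 0|) ⁻¹' A) := by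
  rcases le_total y 1 with hy | hy
  · rw [paretoMeasure_Ioi_of_le hα hy, one_mul]
    refine measure_congr ?_
    filter_upwards [h.exceeds] with ω hω
    exact propext ⟨fun h => h.2, fun h => ⟨hy.trans_lt hω, h⟩⟩
  · have hy0 : 0 < y := zero_lt_one.trans_le hy
    rw [paretoMeasure_Ioi hα hy]
    have hpm : Measurable fun (x : Field d) i => x i / |x 0| := by fun_prop
    have h1 := congrArg (fun μ => μ ((fun (x : Field d) i => x i / |x 0|) ⁻¹' A))
      (h.restrict_exceeds hY hRV hy)
    simp only [Measure.smul_apply, smul_eq_mul] at h1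
    rw [Measure.restrict_apply (hpm hA), Measure.map_apply (by fun_prop) (hpm hA),
      Measure.map_apply hY ((hpm hA).inter (measurableSet_exceeds y 0)),
      Measure.map_apply hY (measurable_const_smul y (hpm hA))] at h1
    have e : (fun x : Field d => y • x) ⁻¹' ((fun (x : Field d) i => x i / |x 0|) ⁻¹' A) =
        (fun (x : Field d) i => x i / |x 0|) ⁻¹' A := by
      ext x
      have : (fun i => (y • x) i / |(y • x) 0|) = fun i => x i / |x 0| := by
        funext i
        rw [Pi.smul_apply, Pi.smul_apply, smul_eq_mul, smul_eq_mul, abs_mul, abs_of_pos hy0,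
          mul_div_mul_left _ _ hy0.ne']
      rw [Set.mem_preimage, Set.mem_preimage, this, Set.mem_preimage]
    rw [e, Set.preimage_inter, Set.inter_comm] at h1
    exact h1

lemma IsTailProcess.map_abs (h : IsTailProcess P' X P Y) (hY : Measurable Y) {α : ℝ} (hα : 0 < α) (hRV : IsRegularlyVaryingField P' X α) :
    P.map (fun ω => |Y ω 0|) = paretoMeasure 1 α := by
  have hm : Measurable fun ω => |Y ω 0| := by fun_prop
  have := isProbabilityMeasure_paretoMeasure zero_lt_one hα
  have : IsProbabilityMeasure (P.map fun ω => |Y ω 0|) :=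
    Measure.isProbabilityMeasure_map hm.aemeasurable
  refine ext_of_generate_finite _ (borel_eq_generateFrom_Ioi ℝ ▸ BorelSpace.measurable_eq)
    isPiSystem_Ioi ?_ (by simp)
  rintro _ ⟨y, rfl⟩
  rw [Measure.map_apply hm measurableSet_Ioi]
  have := h.measure_polar hY hα hRV y MeasurableSet.univ
  rw [Set.preimage_univ, Set.inter_univ, measure_univ, mul_one] at this
  exact this

lemma IsTailProcess.indepFun (h : IsTailProcess P' X P Y) (hY : Measurable Y) {α : ℝ} (hα : 0 < α) (hRV : IsRegularlyVaryingField P' X α) :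
    IndepFun (fun ω => |Y ω 0|) (fun ω i => Y ω i / |Y ω 0|) P := by
  have hm : Measurable fun ω => |Y ω 0| := by fun_prop
  have hm' : Measurable fun ω i => Y ω i / |Y ω 0| := by fun_prop
  have hmap := h.map_abs hY hα hRV
  rw [IndepFun_iff_Indep]
  refine IndepSets.indep (p1 := {s | ∃ t ∈ Set.range (Set.Ioi : ℝ → Set ℝ),
      (fun ω => |Y ω 0|) ⁻¹' t = s})
    (p2 := {s | MeasurableSet[MeasurableSpace.comap (fun ω i => Y ω i / |Y ω 0|) inferInstance] s})
    hm.comap_le hm'.comap_le ?_ 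
    (@MeasurableSpace.isPiSystem_measurableSet _
      (MeasurableSpace.comap (fun ω i => Y ω i / |Y ω 0|) inferInstance)) ?_
    (@MeasurableSpace.generateFrom_measurableSet _
      (MeasurableSpace.comap (fun ω i => Y ω i / |Y ω 0|) inferInstance)).symm ?_
  · exact (isPiSystem_Ioi (α := ℝ)).comap _
  · rw [BorelSpace.measurable_eq (α := ℝ), borel_eq_generateFrom_Ioi, MeasurableSpace.comap_generateFrom]
    rfl
  · rw [IndepSets_iff]
    rintro _ _ ⟨_, ⟨y, rfl⟩, rfl⟩ ⟨A, hA, rfl⟩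
    have h1 : P ((fun ω => |Y ω 0|) ⁻¹' Set.Ioi y) = paretoMeasure 1 α (Set.Ioi y) := by
      rw [← hmap, Measure.map_apply hm measurableSet_Ioi]
    rw [h1]
    exact h.measure_polar hY hα hRV y hA

end Necessity

/-! ### Coordinatewise entry of largest modulus -/

section AbsMax

variable {ι : Type*}

/-- The coordinatewise choice of the entry with the larger modulus. -/
noncomputable def absMax (a b : ι → ℝ) : ι → ℝ := fun i => if |b i| ≤ |a i| then a i else b i

@[fun_prop]
lemma measurable_absMax : Measurable fun p : (ι → ℝ) × (ι → ℝ) => absMax p.1 p.2 := by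
  refine measurable_pi_lambda _ fun i => Measurable.ite (measurableSet_le ?_ ?_) ?_ ?_ <;> fun_prop

@[simp]
lemma absMax_zero_right (a : ι → ℝ) : absMax a 0 = a := by funext i; simp [absMax]

@[simp]
lemma absMax_zero_left (a : ι → ℝ) : absMax 0 a = a := by
  funext i
  by_cases h : a i = 0 <;> simp [absMax, h]

lemma smul_absMax {c : ℝ} (hc : 0 < c) (a b : ι → ℝ) :
    c • absMax a b = absMax (c • a) (c • b) := by
  funext i
  simp only [absMax, Pi.smul_apply, smul_eq_mul, abs_mul, abs_of_pos hc, mul_le_mul_iff_right₀ hc]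
  split_ifs <;> rfl

lemma abs_absMax (a b : ι → ℝ) (i : ι) : |absMax a b i| = max |a i| |b i| := by
  simp only [absMax]
  split_ifs with h
  · rw [max_eq_left h]
  · rw [max_eq_right (not_le.1 h).le]

variable [Fintype ι]

lemma norm_absMax_le_iff (a b : ι → ℝ) {r : ℝ} (hr : 0 ≤ r) :
    ‖absMax a b‖ ≤ r ↔ ‖a‖ ≤ r ∧ ‖b‖ ≤ r := by
  simp only [pi_norm_le_iff_of_nonneg hr, Real.norm_eq_abs, abs_absMax, max_le_iff, forall_and]

lemma norm_absMax_lt_iff (a b : ι → ℝ) {r : ℝ} (hr : 0 < r) :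
    ‖absMax a b‖ < r ↔ ‖a‖ < r ∧ ‖b‖ < r := by
  simp only [pi_norm_lt_iff hr, Real.norm_eq_abs, abs_absMax, max_lt_iff, forall_and]

/-- `absMax` may jump at ties of modulus; this estimate replaces continuity when one argument is
small. An entry is replaced only by one of larger modulus. -/
lemma dist_absMax_left (a b : ι → ℝ) : dist (absMax a b) a ≤ 2 * ‖b‖ := by
  refine (dist_pi_le_iff (by positivity)).2 fun i => ?_
  have hb : |b i| ≤ ‖b‖ := norm_le_pi_norm b i
  simp only [absMax]
  split_ifs with h
  · simp
  · rw [Real.dist_eq]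
    have h1 := abs_sub (b i) (a i)
    linarith

lemma dist_absMax_right (a b : ι → ℝ) : dist (absMax a b) b ≤ 2 * ‖a‖ := by
  refine (dist_pi_le_iff (by positivity)).2 fun i => ?_
  have ha : |a i| ≤ ‖a‖ := norm_le_pi_norm a i
  simp only [absMax]
  split_ifs with h
  · rw [Real.dist_eq]
    have h1 := abs_sub (a i) (b i)
    linarith
  · simp

end AbsMax

/-! ### The compound law and its tail -/

section Compound

variable {ι κ : Type*}

/-- The law of the coordinatewise largest entry among the points of a Poisson process of intensity
`m`, observed until an independent standard exponential time. -/
structure IsCompound (m R : Measure (ι → ℝ)) : Prop where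
  isProbabilityMeasure : IsProbabilityMeasure R
  eq : (1 + m Set.univ) • R = Measure.dirac 0 + (m.prod R).map fun p => absMax p.1 p.2

/-- The law of the coordinatewise largest among `n` points, weighted by the probability that
there are `n` points. -/
noncomputable def compoundTerm (m : Measure (ι → ℝ)) : ℕ → Measure (ι → ℝ)
  | 0 => (1 + m Set.univ)⁻¹ • Measure.dirac 0
  | n + 1 => (1 + m Set.univ)⁻¹ • (m.prod (compoundTerm m n)).map fun p => absMax p.1 p.2

/-- The measure characterized by `IsCompound m`. -/
noncomputable def compound (m : Measure (ι → ℝ)) : Measure (ι → ℝ) :=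
  Measure.sum (compoundTerm m)

variable {m : Measure (ι → ℝ)}

lemma one_add_mass_ne_zero : 1 + m Set.univ ≠ 0 := by simp

variable [IsFiniteMeasure m]

lemma one_add_mass_ne_top : 1 + m Set.univ ≠ ∞ := by simp

lemma smul_inv_smul_mass (μ : Measure (ι → ℝ)) :
    (1 + m Set.univ) • (1 + m Set.univ)⁻¹ • μ = μ := by
  rw [smul_smul, ENNReal.mul_inv_cancel one_add_mass_ne_zero one_add_mass_ne_top, one_smul]

instance isFiniteMeasure_compoundTerm (n : ℕ) : IsFiniteMeasure (compoundTerm m n) := by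
  have h : (1 + m Set.univ)⁻¹ ≠ ∞ := ENNReal.inv_ne_top.2 one_add_mass_ne_zero
  induction n with
  | zero => exact Measure.smul_finite _ h
  | succ n ih => exact Measure.smul_finite _ h

lemma compoundTerm_univ (n : ℕ) : compoundTerm m n Set.univ =
    (m Set.univ / (1 + m Set.univ)) ^ n * (1 + m Set.univ)⁻¹ := by
  induction n with
  | zero => simp [compoundTerm]
  | succ n ih =>
    rw [compoundTerm, Measure.smul_apply, Measure.map_apply (by fun_prop) MeasurableSet.univ,
      Set.preimage_univ, ← Set.univ_prod_univ, Measure.prod_prod, ih, smul_eq_mul, pow_succ,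
      div_eq_mul_inv]
    ring

/-- Either the exponential clock, of rate `1`, rings before the first point, or a first point
arrives and by lack of memory an independent copy follows. -/
lemma compound_eq : (1 + m Set.univ) • compound m =
    Measure.dirac 0 + (m.prod (compound m)).map fun p => absMax p.1 p.2 := by
  have h : compound m = compoundTerm m 0 + Measure.sum fun n => compoundTerm m (n + 1) := by
    ext s hs
    simp only [compound, Measure.add_apply, Measure.sum_apply _ hs]
    exact tsum_eq_zero_add' ENNReal.summable
  have h2 : (m.prod (compound m)).map (fun p => absMax p.1 p.2) =
      Measure.sum fun n => (m.prod (compoundTerm m n)).map fun p => absMax p.1 p.2 := by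
    rw [compound, Measure.prod_sum_right, Measure.map_sum (by fun_prop)]
  rw [h2]
  conv_lhs => rw [h]
  rw [smul_add, compoundTerm, smul_inv_smul_mass]
  congr 1
  ext s hs
  simp only [Measure.smul_apply, Measure.sum_apply _ hs, compoundTerm, smul_eq_mul]
  rw [ENNReal.tsum_mul_left, ← mul_assoc,
    ENNReal.mul_inv_cancel one_add_mass_ne_zero one_add_mass_ne_top, one_mul]

/-- The number of points is geometric, so the total masses of the terms form a geometric series with
sum one. -/
lemma isCompound_compound : IsCompound m (compound m) := by
  refine ⟨⟨?_⟩, compound_eq⟩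
  rw [compound, Measure.sum_apply _ MeasurableSet.univ]
  simp_rw [compoundTerm_univ]
  rw [ENNReal.tsum_mul_right, ENNReal.tsum_geometric]
  have : 1 - m Set.univ / (1 + m Set.univ) = (1 + m Set.univ)⁻¹ := by
    refine ENNReal.sub_eq_of_eq_add (ENNReal.div_lt_top (by simp) (by simp)).ne ?_
    rw [← one_div, ENNReal.div_add_div_same, ENNReal.div_self one_add_mass_ne_zero
      one_add_mass_ne_top]
  rw [this, inv_inv, ENNReal.mul_inv_cancel one_add_mass_ne_zero one_add_mass_ne_top]

/-- Iterating the equation bounds `R` below by every partial sum of the series, hence by `compound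
m`; two ordered probability measures coincide. -/
lemma IsCompound.eq_compound {R : Measure (ι → ℝ)} (hR : IsCompound m R) : R = compound m := by
  have := hR.isProbabilityMeasure
  have := (isCompound_compound (m := m)).isProbabilityMeasure
  have key : ∀ N, ∑ n ∈ Finset.range N, compoundTerm m n ≤ R := by
    intro N
    induction N with
    | zero => simpa using Measure.zero_le R
    | succ N ih =>
      have hR' : R = (1 + m Set.univ)⁻¹ • (1 + m Set.univ) • R := by
        rw [smul_smul, ENNReal.inv_mul_cancel one_add_mass_ne_zero one_add_mass_ne_top, one_smul]
      rw [hR', hR.eq, smul_add, Finset.sum_range_succ', add_comm]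
      refine add_le_add le_rfl ?_
      have e : ∑ n ∈ Finset.range N, compoundTerm m (n + 1) = (1 + m Set.univ)⁻¹ •
          (m.prod (∑ n ∈ Finset.range N, compoundTerm m n)).map fun p => absMax p.1 p.2 := by
        clear ih
        induction N with
        | zero => simp
        | succ N ih =>
          have : IsFiniteMeasure (∑ n ∈ Finset.range N, compoundTerm m n) := inferInstance
          rw [Finset.sum_range_succ, ih, Finset.sum_range_succ, Measure.prod_add,
            Measure.map_add _ _ (by fun_prop), smul_add, compoundTerm]
      rw [e]
      gcongr
      · fun_prop
  refine (Measure.eq_of_le_of_isProbabilityMeasure ?_).symm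
  refine Measure.le_iff.2 fun s hs => ?_
  rw [compound, Measure.sum_apply _ hs]
  refine ENNReal.tsum_le_of_sum_range_le fun N => ?_
  have := key N s
  simpa using this

/-- The law of a subfamily of the coordinates; atoms at `0` of the intensity are irrelevant. -/
lemma IsCompound.map_comp {R : Measure (ι → ℝ)} (hR : IsCompound m R) (f : κ → ι)
    {m' : Measure (κ → ℝ)} [IsFiniteMeasure m'] {c : ℝ≥0∞} (hc : c ≠ ∞)
    (hm : m.map (fun x => x ∘ f) = m' + c • Measure.dirac 0) :
    IsCompound m' (R.map fun x => x ∘ f) := by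
  have := hR.isProbabilityMeasure
  have hf : Measurable fun x : ι → ℝ => x ∘ f :=
    measurable_pi_lambda _ fun i => measurable_pi_apply (f i)
  have hR' : IsProbabilityMeasure (R.map fun x => x ∘ f) :=
    Measure.isProbabilityMeasure_map hf.aemeasurable
  refine ⟨hR', ?_⟩
  have h1 := congrArg (fun μ => μ.map fun x : ι → ℝ => x ∘ f) hR.eq
  simp only [Measure.map_smul, Measure.map_add _ _ hf] at h1
  rw [Measure.map_dirac' hf, Measure.map_map hf (by fun_prop)] at h1
  have h2 : (fun x : ι → ℝ => x ∘ f) ∘ (fun p : (ι → ℝ) × (ι → ℝ) => absMax p.1 p.2) =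
      (fun p : (κ → ℝ) × (κ → ℝ) => absMax p.1 p.2) ∘
        Prod.map (fun x : ι → ℝ => x ∘ f) (fun x : ι → ℝ => x ∘ f) := rfl
  have h3 : m Set.univ = m' Set.univ + c := by
    have := congrArg (fun μ => μ Set.univ) hm
    simpa [Measure.map_apply hf MeasurableSet.univ] using this
  rw [h2, ← Measure.map_map (by fun_prop) (hf.prodMap hf), ← Measure.map_prod_map _ _ hf hf, hm,
    Measure.add_prod, Measure.map_add _ _ (by fun_prop), Measure.prod_smul_left, Measure.map_smul,
    Measure.dirac_prod, Measure.map_map (by fun_prop) (by fun_prop)] at h1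
  have h4 : ((fun p : (κ → ℝ) × (κ → ℝ) => absMax p.1 p.2) ∘ Prod.mk (0 : κ → ℝ)) = id := by
    funext x; simp
  rw [h4, Measure.map_id, h3, ← add_assoc, ← add_assoc, add_smul] at h1
  have h5 : (0 : ι → ℝ) ∘ f = 0 := rfl
  rw [h5] at h1
  ext s hs
  have h6 := congrArg (fun μ => μ s) h1
  simp only [Measure.add_apply, Measure.smul_apply, smul_eq_mul] at h6 ⊢
  -- An atom `c δ_0` of the intensity contributes `c` times the law to both sides, and this finite
  -- term cancels.
  exact (ENNReal.add_left_inj (ENNReal.mul_ne_top hc (measure_ne_top _ _))).1 h6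

variable [Fintype ι]

/-- A ball contains `absMax z x` exactly when it contains both arguments, so the equation closes up
into a scalar one for the mass of the ball. -/
lemma IsCompound.measureReal_norm_gt {R : Measure (ι → ℝ)} (hR : IsCompound m R) {u : ℝ}
    (hu : 0 ≤ u) :
    R.real {x | u < ‖x‖} = m.real {x | u < ‖x‖} / (1 + m.real {x | u < ‖x‖}) := by
  have := hR.isProbabilityMeasure
  have hB : MeasurableSet {x : ι → ℝ | u < ‖x‖} :=
    measurableSet_lt measurable_const measurable_norm
  have h := congrArg (fun μ => μ {x | u < ‖x‖}ᶜ) hR.eq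
  simp only [Measure.smul_apply, Measure.add_apply, smul_eq_mul] at h
  rw [Measure.map_apply (by fun_prop) hB.compl, Measure.dirac_apply' _ hB.compl] at h
  have h1 : (fun p : (ι → ℝ) × (ι → ℝ) => absMax p.1 p.2) ⁻¹' {x | u < ‖x‖}ᶜ =
      {x | u < ‖x‖}ᶜ ×ˢ {x | u < ‖x‖}ᶜ := by
    ext p
    simp [norm_absMax_le_iff _ _ hu]
  rw [h1, Measure.prod_prod, Set.indicator_of_mem (by simpa using hu), Pi.one_apply] at h
  have h2 := congrArg ENNReal.toReal h
  rw [ENNReal.toReal_mul, ENNReal.toReal_add (by simp) (measure_ne_top _ _), ENNReal.toReal_one,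
    ENNReal.toReal_add (by simp) (ENNReal.mul_ne_top (measure_ne_top _ _) (measure_ne_top _ _)),
    ENNReal.toReal_mul, ENNReal.toReal_one] at h2
  simp only [← measureReal_def, probReal_compl_eq_one_sub hB, measureReal_compl hB] at h2
  have h3 : 0 ≤ m.real {x | u < ‖x‖} := measureReal_nonneg
  rw [eq_div_iff (by positivity)]
  linarith

lemma IsCompound.measureReal_norm_gt_le {R : Measure (ι → ℝ)} (hR : IsCompound m R) {u : ℝ}
    (hu : 0 ≤ u) : R.real {x | u < ‖x‖} ≤ m.real {x | u < ‖x‖} := by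
  rw [hR.measureReal_norm_gt hu]
  have h3 : 0 ≤ m.real {x | u < ‖x‖} := measureReal_nonneg
  exact div_le_self h3 (by linarith)

/-- Isolates the interaction of two points: the integrand vanishes if either point is `0`, and will
be small unless both are large. -/
lemma IsCompound.integral_sub {R : Measure (ι → ℝ)} (hR : IsCompound m R) {g : (ι → ℝ) → ℝ}
    (hg : Measurable g) {M : ℝ} (hM : ∀ x, |g x| ≤ M) (hg0 : g 0 = 0) :
    (∫ x, g x ∂ R) - ∫ z, g z ∂m =
      ∫ p, (g (absMax p.1 p.2) - g p.2 - g p.1) ∂(m.prod R) := by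
  have := hR.isProbabilityMeasure
  have hI : ∀ {E : Type _} [MeasurableSpace E] {μ : Measure E} [IsFiniteMeasure μ]
      {h : E → ι → ℝ}, Measurable h → Integrable (fun x => g (h x)) μ := fun hh =>
    Integrable.of_bound (hg.comp hh).aestronglyMeasurable M (ae_of_all _ fun x => hM _)
  have h := congrArg (fun μ => ∫ x, g x ∂μ) hR.eq
  rw [integral_smul_measure, integral_add_measure (f := g) (hI measurable_id) (hI measurable_id),
    integral_map (by fun_prop) hg.aestronglyMeasurable,
    integral_dirac' _ _ hg.stronglyMeasurable, hg0, zero_add,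
    ENNReal.toReal_add (by simp) (measure_ne_top _ _), ENNReal.toReal_one, smul_eq_mul,
    ← measureReal_def] at h
  rw [MeasureTheory.integral_sub, MeasureTheory.integral_sub, integral_fun_snd, integral_fun_fst, ← h]
  · simp; ring
  · exact hI (by fun_prop)
  · exact hI (by fun_prop)
  · exact (hI (by fun_prop)).sub (hI (by fun_prop))
  · exact hI (by fun_prop)

/-- The contribution of two points which are not both large. -/
lemma abs_absMax_sub_le {g : (ι → ℝ) → ℝ} {M ε δ η K : ℝ} (hM : ∀ x, |g x| ≤ M) (hε : 0 < ε)
    (hδ : 0 < δ) (hδε : δ ≤ ε / 2) (hη : 0 ≤ η) (hg0 : ∀ x, ‖x‖ < ε → g x = 0)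
    (hgc : ∀ a b : ι → ℝ, ‖a‖ ≤ K → ‖b‖ ≤ K → dist a b ≤ 2 * δ → |g a - g b| ≤ η)
    (z x : ι → ℝ) :
    |g (absMax z x) - g x - g z| ≤
      3 * M * ({x | K < ‖x‖}.indicator 1 x + {x | K < ‖x‖}.indicator 1 z) +
      3 * M * ({x | δ < ‖x‖}.indicator 1 z * {x | δ < ‖x‖}.indicator 1 x) +
      η * ({x | ε / 2 < ‖x‖}.indicator 1 x + {x | ε / 2 < ‖x‖}.indicator 1 z) := by
  have hM0 : 0 ≤ M := (abs_nonneg _).trans (hM 0)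
  have hi : ∀ (s : Set (ι → ℝ)) x, (0 : ℝ) ≤ s.indicator 1 x := fun s x =>
    Set.indicator_nonneg (fun _ _ => zero_le_one) x
  have htriv : |g (absMax z x) - g x - g z| ≤ 3 * M := by
    have h1 := abs_sub (g (absMax z x) - g x) (g z)
    have h2 := abs_sub (g (absMax z x)) (g x)
    linarith [hM (absMax z x), hM x, hM z]
  have p1 : 0 ≤ 3 * M * ({x | K < ‖x‖}.indicator 1 x + {x | K < ‖x‖}.indicator 1 z) :=
    mul_nonneg (by positivity) (add_nonneg (hi _ _) (hi _ _))
  have p2 : 0 ≤ 3 * M * ({x | δ < ‖x‖}.indicator 1 z * {x | δ < ‖x‖}.indicator 1 x) :=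
    mul_nonneg (by positivity) (mul_nonneg (hi _ _) (hi _ _))
  have p3 : 0 ≤ η * ({x | ε / 2 < ‖x‖}.indicator 1 x + {x | ε / 2 < ‖x‖}.indicator 1 z) :=
    mul_nonneg hη (add_nonneg (hi _ _) (hi _ _))
  by_cases hK : K < ‖x‖ ∨ K < ‖z‖
  · have : (1 : ℝ) ≤ {x | K < ‖x‖}.indicator 1 x + {x | K < ‖x‖}.indicator 1 z := by
      rcases hK with h | h
      · rw [Set.indicator_of_mem (show x ∈ {x | K < ‖x‖} from h)]
        simpa using hi _ _
      · rw [Set.indicator_of_mem (show z ∈ {x | K < ‖x‖} from h)]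
        simpa using hi _ _
    have : 3 * M * 1 ≤ 3 * M * _ := mul_le_mul_of_nonneg_left this (by positivity)
    linarith
  push Not at hK
  obtain ⟨hxK, hzK⟩ := hK
  have hK0 : 0 ≤ K := (norm_nonneg _).trans hxK
  have hopK : ‖absMax z x‖ ≤ K := (norm_absMax_le_iff _ _ hK0).2 ⟨hzK, hxK⟩
  by_cases hz : δ < ‖z‖
  · by_cases hx : δ < ‖x‖
    · have e : ({x | δ < ‖x‖}.indicator 1 z * {x | δ < ‖x‖}.indicator 1 x : ℝ) = 1 := by
        rw [Set.indicator_of_mem (show z ∈ {x | δ < ‖x‖} from hz),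
          Set.indicator_of_mem (show x ∈ {x | δ < ‖x‖} from hx)]
        simp
      rw [e]
      linarith
    -- Only `z` can matter: either all three terms vanish, or `g` is compared at two points at
    -- distance at most `2δ`.
    · push Not at hx
      have hgx : g x = 0 := hg0 x (by linarith)
      by_cases hz' : ‖z‖ < ε
      · have hop : g (absMax z x) = 0 :=
          hg0 _ ((norm_absMax_lt_iff _ _ hε).2 ⟨hz', by linarith⟩)
        rw [hgx, hop, hg0 z hz']
        simp only [sub_zero, abs_zero]
        linarith
      · have h1 : |g (absMax z x) - g x - g z| ≤ η := by
          rw [hgx, sub_zero]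
          exact hgc _ _ hopK hzK ((dist_absMax_left _ _).trans (by linarith))
        have h2 : (1 : ℝ) ≤ {x | ε / 2 < ‖x‖}.indicator 1 x + {x | ε / 2 < ‖x‖}.indicator 1 z := by
          rw [Set.indicator_of_mem (show z ∈ {x | ε / 2 < ‖x‖} from by
            change ε / 2 < _; linarith)]
          simpa using hi _ _
        have : η * 1 ≤ η * _ := mul_le_mul_of_nonneg_left h2 hη
        linarith
  · push Not at hz
    have hgz : g z = 0 := hg0 z (by linarith)
    by_cases hx' : ‖x‖ < ε
    · have hop : g (absMax z x) = 0 :=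
        hg0 _ ((norm_absMax_lt_iff _ _ hε).2 ⟨by linarith, hx'⟩)
      rw [hgz, hop, hg0 x hx']
      simp only [sub_zero, abs_zero]
      linarith
    · have h1 : |g (absMax z x) - g x - g z| ≤ η := by
        rw [hgz, sub_zero]
        exact hgc _ _ hopK hxK ((dist_absMax_right _ _).trans (by linarith))
      have h2 : (1 : ℝ) ≤ {x | ε / 2 < ‖x‖}.indicator 1 x + {x | ε / 2 < ‖x‖}.indicator 1 z := by
        rw [Set.indicator_of_mem (show x ∈ {x | ε / 2 < ‖x‖} from by
          change ε / 2 < _; linarith)]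
        simpa using hi _ _
      have : η * 1 ≤ η * _ := mul_le_mul_of_nonneg_left h2 hη
      linarith

/-- With tails of order `u^(-α)`, the middle term is of order `u^(-2α)`; the outer two are made
small relative to `u^(-α)` by a large `K` and a small `η`. -/
lemma IsCompound.abs_integral_sub_le {R : Measure (ι → ℝ)} (hR : IsCompound m R)
    {g : (ι → ℝ) → ℝ} (hg : Continuous g) {M ε δ η K u : ℝ} (hu : 0 < u) (hM : ∀ x, |g x| ≤ M)
    (hε : 0 < ε)
    (hδ : 0 < δ) (hδε : δ ≤ ε / 2) (hη : 0 ≤ η) (hK : 0 < K) (hg0 : ∀ x, ‖x‖ < ε → g x = 0)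
    (hgc : ∀ a b : ι → ℝ, ‖a‖ ≤ K → ‖b‖ ≤ K → dist a b ≤ 2 * δ → |g a - g b| ≤ η) :
    |(∫ x, g (u⁻¹ • x) ∂ R) - ∫ z, g (u⁻¹ • z) ∂m| ≤
      3 * M * (m.real Set.univ + 1) * m.real {x | u * K < ‖x‖} +
      3 * M * m.real {x | u * δ < ‖x‖} ^ 2 +
      η * (m.real Set.univ + 1) * m.real {x | u * (ε / 2) < ‖x‖} := by
  have := hR.isProbabilityMeasure
  have hM0 : 0 ≤ M := (abs_nonneg _).trans (hM 0)
  have hui : 0 < u⁻¹ := inv_pos.2 hu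
  have hms : ∀ r : ℝ, MeasurableSet {x : ι → ℝ | r < ‖x‖} := fun r =>
    measurableSet_lt measurable_const measurable_norm
  have hind : ∀ r : ℝ, ∀ x : ι → ℝ, {x | r < ‖x‖}.indicator (1 : (ι → ℝ) → ℝ) (u⁻¹ • x) =
      {x | u * r < ‖x‖}.indicator 1 x := by
    intro r x
    have : r < ‖u⁻¹ • x‖ ↔ u * r < ‖x‖ := by
      rw [norm_smul, norm_inv, Real.norm_of_nonneg hu.le, lt_inv_mul_iff₀ hu]
    simp only [Set.indicator_apply, Set.mem_ofPred_eq, this, Pi.one_apply]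
  have e := hR.integral_sub (g := fun x => g (u⁻¹ • x)) (hg.comp (continuous_const_smul _)).measurable
    (fun x => hM _) (by rw [smul_zero]; exact hg0 0 (by simpa using hε))
  rw [e]
  have hint : ∀ r : ℝ, ∀ {μ : Measure (ι → ℝ)} [IsFiniteMeasure μ],
      Integrable ({x : ι → ℝ | r < ‖x‖}.indicator (1 : (ι → ℝ) → ℝ)) μ := fun r μ _ =>
    (integrable_const (1 : ℝ)).indicator (hms r)
  have hval : ∀ r : ℝ, ∀ {μ : Measure (ι → ℝ)} [IsFiniteMeasure μ],
      ∫ x, {x : ι → ℝ | r < ‖x‖}.indicator (1 : (ι → ℝ) → ℝ) x ∂μ = μ.real {x | r < ‖x‖} :=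
    fun r μ _ => integral_indicator_one (hms r)
  have hb : ∀ r : ℝ, 0 < r → ∫ p : (ι → ℝ) × (ι → ℝ), ({x | r < ‖x‖}.indicator 1 p.2 +
      {x | r < ‖x‖}.indicator 1 p.1 : ℝ) ∂(m.prod R) ≤
      (m.real Set.univ + 1) * m.real {x | r < ‖x‖} := by
    intro r hr
    rw [integral_add ((hint r).comp_snd m) ((hint r).comp_fst R), integral_fun_snd,
      integral_fun_fst, hval, hval, add_mul]
    have h1 := hR.measureReal_norm_gt_le hr.le
    simp only [smul_eq_mul, probReal_univ]
    gcongr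
  have hI1 : ∀ r : ℝ, Integrable (fun p : (ι → ℝ) × (ι → ℝ) => ({x | r < ‖x‖}.indicator 1 p.2 +
      {x | r < ‖x‖}.indicator 1 p.1 : ℝ)) (m.prod R) := fun r =>
    ((hint r).comp_snd m).add ((hint r).comp_fst R)
  have hI2 : Integrable (fun p : (ι → ℝ) × (ι → ℝ) => ({x | u * δ < ‖x‖}.indicator 1 p.1 *
      {x | u * δ < ‖x‖}.indicator 1 p.2 : ℝ)) (m.prod R) := (hint _).mul_prod (hint _)
  have hb2 : ∫ p : (ι → ℝ) × (ι → ℝ), ({x | u * δ < ‖x‖}.indicator 1 p.1 *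
      {x | u * δ < ‖x‖}.indicator 1 p.2 : ℝ) ∂(m.prod R) ≤ m.real {x | u * δ < ‖x‖} ^ 2 := by
    rw [integral_prod_mul, hval, hval, sq]
    exact mul_le_mul_of_nonneg_left (hR.measureReal_norm_gt_le (by positivity)) measureReal_nonneg
  have hpt : ∀ p : (ι → ℝ) × (ι → ℝ),
      |g (u⁻¹ • absMax p.1 p.2) - g (u⁻¹ • p.2) - g (u⁻¹ • p.1)| ≤
      3 * M * ({x | u * K < ‖x‖}.indicator 1 p.2 + {x | u * K < ‖x‖}.indicator 1 p.1) +
      3 * M * ({x | u * δ < ‖x‖}.indicator 1 p.1 * {x | u * δ < ‖x‖}.indicator 1 p.2) +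
      η * ({x | u * (ε / 2) < ‖x‖}.indicator 1 p.2 +
        {x | u * (ε / 2) < ‖x‖}.indicator 1 p.1) := fun p => by
    rw [smul_absMax hui]
    have := abs_absMax_sub_le hM hε hδ hδε hη hg0 hgc (u⁻¹ • p.1) (u⁻¹ • p.2)
    simpa only [hind] using this
  calc |∫ p : (ι → ℝ) × (ι → ℝ),
        (g (u⁻¹ • absMax p.1 p.2) - g (u⁻¹ • p.2) - g (u⁻¹ • p.1)) ∂(m.prod R)|
      ≤ ∫ p : (ι → ℝ) × (ι → ℝ), |g (u⁻¹ • absMax p.1 p.2) - g (u⁻¹ • p.2) - g (u⁻¹ • p.1)|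
          ∂(m.prod R) := abs_integral_le_integral_abs
    _ ≤ _ := integral_mono_of_nonneg (ae_of_all _ fun p => abs_nonneg _)
        ((((hI1 _).const_mul _).add (hI2.const_mul _)).add ((hI1 _).const_mul _))
        (ae_of_all _ hpt)
    _ ≤ _ := by
      rw [integral_add', integral_add', integral_const_mul, integral_const_mul, integral_const_mul]
      · have h1 := mul_le_mul_of_nonneg_left (hb (u * K) (by positivity))
          (show 0 ≤ 3 * M by positivity)
        have h2 := mul_le_mul_of_nonneg_left hb2 (show 0 ≤ 3 * M by positivity)
        have h3 := mul_le_mul_of_nonneg_left (hb (u * (ε / 2)) (by positivity)) hη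
        linarith
      · exact (hI1 _).const_mul _
      · exact hI2.const_mul _
      · exact ((hI1 _).const_mul _).add (hI2.const_mul _)
      · exact (hI1 _).const_mul _

/-- A single large point dominates: `R` and `m` have the same asymptotic behaviour. -/
lemma IsCompound.tendsto_sub {R : Measure (ι → ℝ)} (hR : IsCompound m R) {α C : ℝ} (hα : 0 < α)
    (htail : ∀ v : ℝ, 0 < v → m.real {x | v < ‖x‖} ≤ C * v ^ (-α))
    {g : (ι → ℝ) → ℝ} (hg : Continuous g) {M ε : ℝ} (hM : ∀ x, |g x| ≤ M) (hε : 0 < ε)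
    (hg0 : ∀ x, ‖x‖ < ε → g x = 0) :
    Tendsto (fun u : ℝ => u ^ α * ((∫ x, g (u⁻¹ • x) ∂ R) - ∫ z, g (u⁻¹ • z) ∂m)) atTop (𝓝 0) := by
  have hM0 : 0 ≤ M := (abs_nonneg _).trans (hM 0)
  have hC : 0 ≤ C := by
    have := htail 1 one_pos
    rw [Real.one_rpow, mul_one] at this
    exact measureReal_nonneg.trans this
  set L := m.real Set.univ + 1 with hL
  have hL0 : 0 < L := by positivity
  rw [Metric.tendsto_atTop']
  intro ξ hξ
  -- choice of the cut-off levels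
  obtain ⟨K, hK, hK0⟩ : ∃ K : ℝ, 3 * M * L * (C * K ^ (-α)) < ξ / 3 ∧ 0 < K := by
    have h1 : Tendsto (fun K : ℝ => 3 * M * L * (C * K ^ (-α))) atTop (𝓝 (3 * M * L * (C * 0))) :=
      ((tendsto_rpow_neg_atTop hα).const_mul C).const_mul _
    rw [mul_zero, mul_zero] at h1
    exact ((h1.eventually (gt_mem_nhds (by positivity : (0 : ℝ) < ξ / 3))).and
      (eventually_gt_atTop 0)).exists
  set D := L * (C * (ε / 2) ^ (-α)) with hD
  have hD0 : 0 ≤ D := by positivity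
  -- `D` may vanish, hence `D + 1`. The order of choice matters: `K`, then `η`, then `δ` from
  -- uniform continuity on the ball of radius `K`, and `u` last.
  set η := ξ / 3 / (D + 1) with hη
  have hη0 : 0 < η := by positivity
  have hηD : η * D < ξ / 3 := by
    rw [hη, div_mul_eq_mul_div, div_lt_iff₀ (by positivity)]
    have : 0 < ξ / 3 := by positivity
    nlinarith
  obtain ⟨δ, hδ0, hδε, hδ⟩ : ∃ δ > 0, δ ≤ ε / 2 ∧ ∀ a b : ι → ℝ, ‖a‖ ≤ K → ‖b‖ ≤ K →
      dist a b ≤ 2 * δ → |g a - g b| ≤ η := by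
    have huc := (isCompact_closedBall (0 : ι → ℝ) K).uniformContinuousOn_of_continuous
      hg.continuousOn
    rw [Metric.uniformContinuousOn_iff_le] at huc
    obtain ⟨δ, hδ, h⟩ := huc η hη0
    refine ⟨min (δ / 2) (ε / 2), by positivity, min_le_right _ _, fun a b ha hb hab => ?_⟩
    have := h a (by simpa using ha) b (by simpa using hb)
      (by linarith [min_le_left (δ / 2) (ε / 2)])
    rwa [Real.dist_eq] at this
  have hlim : Tendsto (fun u : ℝ => 3 * M * (C * δ ^ (-α)) ^ 2 * u ^ (-α)) atTop (𝓝 0) := by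
    simpa using (tendsto_rpow_neg_atTop hα).const_mul (3 * M * (C * δ ^ (-α)) ^ 2)
  obtain ⟨N, hN⟩ := (hlim.eventually (gt_mem_nhds (by positivity : (0 : ℝ) < ξ / 3))).exists_forall_of_atTop
  refine ⟨max N 1, fun u hu => ?_⟩
  have hu0 : 0 < u := by linarith [le_max_right N 1]
  have huN := hN u ((le_max_left N 1).trans hu.le)
  have hb := hR.abs_integral_sub_le hg hu0 hM hε hδ0 hδε hη0.le hK0 hg0 hδ
  have hua : 0 < u ^ α := Real.rpow_pos_of_pos hu0 α
  have hun : u ^ α * u ^ (-α) = 1 := by rw [← Real.rpow_add hu0]; simp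
  have ht : ∀ r : ℝ, 0 < r → m.real {x | u * r < ‖x‖} ≤ C * r ^ (-α) * u ^ (-α) := fun r hr => by
    refine (htail (u * r) (by positivity)).trans_eq ?_
    rw [Real.mul_rpow hu0.le hr.le]; ring
  rw [Real.dist_eq, sub_zero, abs_mul, abs_of_pos hua]
  calc u ^ α * |(∫ x, g (u⁻¹ • x) ∂ R) - ∫ z, g (u⁻¹ • z) ∂m|
      ≤ u ^ α * (3 * M * L * (C * K ^ (-α) * u ^ (-α)) +
          3 * M * (C * δ ^ (-α) * u ^ (-α)) ^ 2 + η * L * (C * (ε / 2) ^ (-α) * u ^ (-α))) := by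
        refine mul_le_mul_of_nonneg_left (hb.trans ?_) hua.le
        gcongr
        · exact ht K hK0
        · exact ht δ hδ0
        · exact ht _ (by positivity)
    _ = (u ^ α * u ^ (-α)) * (3 * M * L * (C * K ^ (-α)) +
          3 * M * (C * δ ^ (-α)) ^ 2 * u ^ (-α) + η * D) := by rw [hD]; ring
    _ < ξ := by rw [hun]; linarith

end Compound

/-! ### The radial measure -/

section PowerMeasure

/-- The measure `α r^(-α-1) dr` on `(0, ∞)`. -/
noncomputable def powerMeasure (α : ℝ) : Measure ℝ :=
  volume.withDensity ((Set.Ioi 0).indicator fun r => ENNReal.ofReal (α * r ^ (-(α + 1))))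

lemma measurable_powerDensity (α : ℝ) : Measurable
    ((Set.Ioi (0 : ℝ)).indicator fun r : ℝ => ENNReal.ofReal (α * r ^ (-(α + 1)))) :=
  Measurable.indicator (by fun_prop) measurableSet_Ioi

instance (α : ℝ) : SFinite (powerMeasure α) := by unfold powerMeasure; infer_instance

lemma powerMeasure_restrict_Ioi (α : ℝ) :
    (powerMeasure α).restrict (Set.Ioi 1) = paretoMeasure 1 α := by
  rw [powerMeasure, restrict_withDensity measurableSet_Ioi, paretoMeasure,
    ← withDensity_indicator measurableSet_Ioi]
  refine withDensity_congr_ae ?_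
  -- The two densities differ at `1`, which the Pareto density includes and `Set.Ioi 1` does not.
  have : ∀ᵐ r : ℝ, r ≠ 1 := by simp [ae_iff]
  filter_upwards [this] with r hr
  by_cases h : 1 < r
  · have h0 : 0 < r := by linarith
    rw [Set.indicator_of_mem (Set.mem_Ioi.2 h), Set.indicator_of_mem (Set.mem_Ioi.2 h0),
      paretoPDF_of_le h.le, Real.one_rpow, mul_one]
  · rw [Set.indicator_of_notMem (by simpa using h), paretoPDF_of_lt]
    exact lt_of_le_of_ne (not_lt.1 h) hr

lemma ae_powerMeasure_pos (α : ℝ) : ∀ᵐ r ∂(powerMeasure α), 0 < r := by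
  rw [powerMeasure, ae_withDensity_iff (measurable_powerDensity α)]
  refine ae_of_all _ fun r hr => ?_
  by_contra h
  exact hr (Set.indicator_of_notMem (by simpa using h) _)

/-- The density gains `t^(α+1)` under `r ↦ t r` and the Jacobian takes back one power of `t`. -/
lemma lintegral_powerMeasure_comp_mul {α t : ℝ} (ht : 0 < t) {g : ℝ → ℝ≥0∞} (hg : Measurable g) :
    ∫⁻ r, g (t * r) ∂(powerMeasure α) = ENNReal.ofReal (t ^ α) * ∫⁻ r, g r ∂(powerMeasure α) := by
  rw [powerMeasure, lintegral_withDensity_eq_lintegral_mul _ (measurable_powerDensity α) (by fun_prop),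
    lintegral_withDensity_eq_lintegral_mul _ (measurable_powerDensity α) hg]
  set ρ : ℝ → ℝ≥0∞ := (Set.Ioi (0 : ℝ)).indicator fun r : ℝ => ENNReal.ofReal (α * r ^ (-(α + 1)))
    with hρ
  have hρm : Measurable ρ := measurable_powerDensity α
  have h1 : ∀ r, ρ r = ENNReal.ofReal (t ^ (α + 1)) * ρ (t * r) := by
    intro r
    by_cases hr : 0 < r
    · have hp : (0 : ℝ) < t ^ (α + 1) := Real.rpow_pos_of_pos ht _
      rw [hρ, Set.indicator_of_mem (Set.mem_Ioi.2 hr),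
        Set.indicator_of_mem (Set.mem_Ioi.2 (mul_pos ht hr)), ← ENNReal.ofReal_mul hp.le,
        Real.mul_rpow ht.le hr.le, Real.rpow_neg ht.le]
      congr 1
      field_simp
    · have : ¬ 0 < t * r := by rwa [mul_pos_iff_of_pos_left ht]
      rw [hρ, Set.indicator_of_notMem (by simpa using hr),
        Set.indicator_of_notMem (by simpa using this), mul_zero]
  calc ∫⁻ r, (ρ * fun r => g (t * r)) r
      = ∫⁻ r, ENNReal.ofReal (t ^ (α + 1)) * (ρ (t * r) * g (t * r)) := by
        refine lintegral_congr fun r => ?_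
        rw [Pi.mul_apply, h1, mul_assoc]
    _ = ENNReal.ofReal (t ^ (α + 1)) * ∫⁻ r, (ρ * g) r ∂(volume.map fun r => t * r) := by
        rw [lintegral_const_mul _ (by fun_prop), lintegral_map (hρm.mul hg) (by fun_prop)]
        rfl
    _ = ENNReal.ofReal (t ^ α) * ∫⁻ r, (ρ * g) r := by
        rw [Real.map_volume_mul_left ht.ne', lintegral_smul_measure, smul_eq_mul, ← mul_assoc,
          ← ENNReal.ofReal_mul (by positivity), abs_of_pos (inv_pos.2 ht), Real.rpow_add ht,
          Real.rpow_one, mul_inv_cancel_right₀ ht.ne']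

end PowerMeasure

/-! ### The tail measure on fields not vanishing at the origin -/

/-- The field divided by the modulus of its value at the origin. -/
noncomputable def normalize (x : Field d) : Field d := fun i => x i / |x 0|

@[fun_prop]
lemma measurable_normalize : Measurable (normalize : Field d → Field d) := by
  unfold normalize; fun_prop

/-- Laws of fields with `|Y_0| > 1` that satisfy the time-change formula and such that `|Y_0|` is
Pareto distributed and independent of `Y / |Y_0|`. -/
structure IsTailLaw (α : ℝ) (Q : Measure (Field d)) : Prop where
  isProbabilityMeasure : IsProbabilityMeasure Q
  timeChange : TimeChange Q
  exceeds : ∀ᵐ x ∂Q, 1 < |x 0|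
  polar : Q = ((paretoMeasure 1 α).prod (Q.map normalize)).map fun p => p.1 • p.2

/-- The tail measure restricted to the fields that do not vanish at the origin. -/
noncomputable def originMeasure (α : ℝ) (Q : Measure (Field d)) : Measure (Field d) :=
  ((powerMeasure α).prod (Q.map normalize)).map fun p => p.1 • p.2

section

variable {α : ℝ} {Q : Measure (Field d)}

instance [SFinite Q] : SFinite (originMeasure α Q) := by unfold originMeasure; infer_instance

lemma IsTailLaw.ae_normalize (hQ : IsTailLaw α Q) : ∀ᵐ x ∂(Q.map normalize), |x 0| = 1 := by
  rw [ae_map_iff (by fun_prop) (measurableSet_eq_fun (by fun_prop) measurable_const)]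
  filter_upwards [hQ.exceeds] with x hx
  rw [normalize, abs_div, abs_abs, div_self (by linarith)]

lemma IsTailLaw.ae_prod (hQ : IsTailLaw α Q) :
    ∀ᵐ p ∂((powerMeasure α).prod (Q.map normalize)), 0 < p.1 ∧ |p.2 0| = 1 := by
  have := hQ.isProbabilityMeasure
  have h1 := Measure.quasiMeasurePreserving_fst (μ := powerMeasure α) (ν := Q.map normalize)
    |>.ae (ae_powerMeasure_pos α)
  have h2 := Measure.quasiMeasurePreserving_snd (μ := powerMeasure α) (ν := Q.map normalize)
    |>.ae hQ.ae_normalize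
  filter_upwards [h1, h2] with p hp1 hp2 using ⟨hp1, hp2⟩

/-- Normalized fields have modulus `1` at the origin, so `|x_0|` is the radius; cutting the power
law at `1` leaves the Pareto law, and the polar decomposition returns `Q`. -/
lemma IsTailLaw.restrict_originMeasure (hQ : IsTailLaw α Q) :
    (originMeasure α Q).restrict {x | 1 < |x 0|} = Q := by
  have := hQ.isProbabilityMeasure
  conv_rhs => rw [hQ.polar]
  rw [originMeasure, Measure.restrict_map (by fun_prop) (measurableSet_exceeds 1 0)]
  congr 1
  rw [← powerMeasure_restrict_Ioi, ← Measure.restrict_univ (μ := Q.map normalize),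
    Measure.prod_restrict, Measure.restrict_univ]
  refine Measure.restrict_congr_set ?_
  filter_upwards [hQ.ae_prod] with p hp
  apply propext
  change 1 < |p.1 * p.2 0| ↔ _ ∧ _
  rw [abs_mul, hp.2, mul_one, abs_of_pos hp.1]
  simp

lemma IsTailLaw.ae_originMeasure (hQ : IsTailLaw α Q) : ∀ᵐ x ∂(originMeasure α Q), x 0 ≠ 0 := by
  have hm : MeasurableSet {x : Field d | x 0 ≠ 0} :=
    (measurableSet_eq_fun (by fun_prop) measurable_const).compl
  rw [originMeasure, ae_map_iff (by fun_prop) hm]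
  filter_upwards [hQ.ae_prod] with p hp
  refine mul_ne_zero hp.1.ne' fun h => ?_
  have := hp.2
  rw [h, abs_zero] at this
  exact zero_ne_one this

lemma IsTailLaw.lintegral_originMeasure_smul (hQ : IsTailLaw α Q) {t : ℝ} (ht : 0 < t)
    {h : Field d → ℝ≥0∞} (hh : Measurable h) :
    ∫⁻ x, h (t • x) ∂(originMeasure α Q) =
      ENNReal.ofReal (t ^ α) * ∫⁻ x, h x ∂(originMeasure α Q) := by
  have := hQ.isProbabilityMeasure
  rw [originMeasure, lintegral_map (by fun_prop) (by fun_prop), lintegral_map hh (by fun_prop),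
    lintegral_prod_symm _ (by fun_prop), lintegral_prod_symm _ (by fun_prop),
    ← lintegral_const_mul' _ _ ENNReal.ofReal_ne_top]
  refine lintegral_congr fun y => ?_
  have hm : Measurable fun r : ℝ => h (r • y) := by fun_prop
  have := lintegral_powerMeasure_comp_mul (α := α) ht hm
  simpa only [mul_smul] using this

lemma IsTailLaw.originMeasure_smul (hQ : IsTailLaw α Q) {t : ℝ} (ht : 0 < t)
    {A : Set (Field d)} (hA : MeasurableSet A) :
    originMeasure α Q ((fun x => t • x) ⁻¹' A) =
      ENNReal.ofReal (t ^ α) * originMeasure α Q A := by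
  have h := hQ.lintegral_originMeasure_smul ht (measurable_const.indicator hA : Measurable
    (A.indicator fun _ => (1 : ℝ≥0∞)))
  rw [lintegral_indicator_const hA, one_mul] at h
  rw [← h, ← one_mul (originMeasure α Q _),
    ← lintegral_indicator_const (measurable_const_smul t hA)]
  rfl

lemma IsTailLaw.originMeasure_exceeds (hQ : IsTailLaw α Q) {s : ℝ} (hs : 0 < s) :
    originMeasure α Q {x | s < |x 0|} = ENNReal.ofReal (s ^ (-α)) := by
  have := hQ.isProbabilityMeasure
  have h := hQ.originMeasure_smul (inv_pos.2 hs) (measurableSet_exceeds (d := d) 1 0)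
  have h1 : originMeasure α Q {x | 1 < |x 0|} = 1 := by
    rw [← Measure.restrict_apply_univ, hQ.restrict_originMeasure, measure_univ]
  rw [h1, mul_one, Real.inv_rpow hs.le, ← Real.rpow_neg hs.le] at h
  rw [← h]
  congr 1
  ext x
  simp only [Set.mem_preimage, Set.mem_ofPred_eq, Pi.smul_apply, smul_eq_mul, abs_mul, abs_inv,
    abs_of_pos hs]
  rw [lt_inv_mul_iff₀ hs, mul_one]

/-- The time-change formula is the case `s = 1`; homogeneity carries it to every threshold. -/
lemma IsTailLaw.originMeasure_exceeds_inter (hQ : IsTailLaw α Q) (k : Fin d → ℤ)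
    {A : Set (Field d)} (hA : MeasurableSet A) {s : ℝ} (hs : 0 < s) :
    originMeasure α Q ({x | s < |x 0|} ∩ ({x | s < |x k|} ∩ shift k ⁻¹' A)) =
      originMeasure α Q ({x | s < |x 0|} ∩ ({x | s < |x (-k)|} ∩ A)) := by
  have hsα : ENNReal.ofReal (s ^ α) ≠ 0 := by simpa using Real.rpow_pos_of_pos hs α
  refine (ENNReal.mul_right_inj hsα ENNReal.ofReal_ne_top).1 ?_
  have hms := measurableSet_exceeds (d := d)
  have hsc : ∀ i : Fin d → ℤ, (fun x : Field d => s • x) ⁻¹' {x | s < |x i|} =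
      {x | 1 < |x i|} := by
    intro i
    ext x
    simp [abs_mul, abs_of_pos hs, hs]
  rw [← hQ.originMeasure_smul hs ((hms s 0).inter ((hms s k).inter (measurable_shift k hA))),
    ← hQ.originMeasure_smul hs ((hms s 0).inter ((hms s (-k)).inter hA))]
  simp only [Set.preimage_inter, hsc]
  have hAs : MeasurableSet ((fun x : Field d => s • x) ⁻¹' A) := measurable_const_smul s hA
  have h := hQ.timeChange.measure_eq k hAs
  rw [← hQ.restrict_originMeasure, Measure.restrict_apply ((hms 1 k).inter (measurable_shift k hAs)),
    Measure.restrict_apply ((hms 1 (-k)).inter hAs), Set.inter_comm, Set.inter_comm _ {x | _}] at h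
  exact h

/-- Letting the threshold decrease to `0` along `1/(n+1)` turns the time-change formula into shift
invariance of the tail measure. -/
lemma IsTailLaw.map_shift_originMeasure (hQ : IsTailLaw α Q) (k : Fin d → ℤ) :
    ((originMeasure α Q).restrict {x | x k ≠ 0}).map (shift k) =
      (originMeasure α Q).restrict {x | x (-k) ≠ 0} := by
  have hmon : ∀ (i : Fin d → ℤ) (A : Set (Field d)), Monotone fun n : ℕ =>
      {x : Field d | 1 / ((n : ℝ) + 1) < |x 0|} ∩ ({x | 1 / ((n : ℝ) + 1) < |x i|} ∩ A) := by
    intro i A m n hmn x hx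
    have : 1 / ((n : ℝ) + 1) ≤ 1 / ((m : ℝ) + 1) := Nat.one_div_le_one_div hmn
    exact ⟨this.trans_lt hx.1, this.trans_lt hx.2.1, hx.2.2⟩
  have hun : ∀ (i : Fin d → ℤ) (A : Set (Field d)), originMeasure α Q (A ∩ {x | x i ≠ 0}) =
      originMeasure α Q (⋃ n : ℕ, {x : Field d | 1 / ((n : ℝ) + 1) < |x 0|} ∩
        ({x | 1 / ((n : ℝ) + 1) < |x i|} ∩ A)) := by
    intro i A
    refine measure_congr ?_
    filter_upwards [hQ.ae_originMeasure] with x hx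
    apply propext
    change (_ ∧ x i ≠ 0) ↔ x ∈ ⋃ n : ℕ, _
    rw [Set.mem_iUnion]
    constructor
    · rintro ⟨hxA, hxi⟩
      obtain ⟨n, hn⟩ := exists_nat_one_div_lt (lt_min (abs_pos.2 hx) (abs_pos.2 hxi))
      exact ⟨n, hn.trans_le (min_le_left _ _), hn.trans_le (min_le_right _ _), hxA⟩
    · rintro ⟨n, -, h1, h2⟩
      refine ⟨h2, abs_pos.1 (lt_trans ?_ h1)⟩
      positivity
  have hm : ∀ i : Fin d → ℤ, MeasurableSet {x : Field d | x i ≠ 0} := fun i =>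
    (measurableSet_eq_fun (by fun_prop) measurable_const).compl
  ext A hA
  rw [Measure.map_apply (measurable_shift k) hA, Measure.restrict_apply hA,
    Measure.restrict_apply (measurable_shift k hA), hun, hun, (hmon _ _).measure_iUnion,
    (hmon _ _).measure_iUnion]
  refine iSup_congr fun n => hQ.originMeasure_exceeds_inter k hA ?_
  positivity

lemma IsTailLaw.lintegral_shift (hQ : IsTailLaw α Q) (k : Fin d → ℤ) {h : Field d → ℝ≥0∞}
    (hh : Measurable h) (h0 : ∀ x, x 0 = 0 → h x = 0) (hk : ∀ x, x (-k) = 0 → h x = 0) :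
    ∫⁻ x, h (shift k x) ∂(originMeasure α Q) = ∫⁻ x, h x ∂(originMeasure α Q) := by
  have h1 := congrArg (fun μ => ∫⁻ x, h x ∂μ) (hQ.map_shift_originMeasure k)
  simp only [lintegral_map hh (measurable_shift k)] at h1
  rwa [setLIntegral_eq_of_support_subset, setLIntegral_eq_of_support_subset] at h1
  · intro x hx hx0
    exact hx (hk x hx0)
  · intro x hx hx0
    exact hx (h0 _ (by simpa using hx0))

/-! ### The tail measure on finite blocks -/

/-- The weight of the coordinate `i` within the block `I`. -/
noncomputable def weight {ι : Type*} [Fintype ι] (v : ι → ℝ) (i : ι) : ℝ≥0∞ :=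
  ENNReal.ofReal |v i| / ∑ j, ENNReal.ofReal |v j|

@[fun_prop]
lemma measurable_weight {ι : Type*} [Fintype ι] (i : ι) :
    Measurable fun v : ι → ℝ => weight v i := by
  unfold weight; fun_prop

lemma weight_eq_zero {ι : Type*} [Fintype ι] {v : ι → ℝ} {i : ι} (h : v i = 0) :
    weight v i = 0 := by simp [weight, h]

lemma sum_weight {ι : Type*} [Fintype ι] {v : ι → ℝ} (hv : v ≠ 0) : ∑ i, weight v i = 1 := by
  obtain ⟨i, hi⟩ := Function.ne_iff.1 hv
  simp only [weight, div_eq_mul_inv]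
  rw [← Finset.sum_mul]
  refine ENNReal.mul_inv_cancel (fun h => ?_) (ENNReal.sum_ne_top.2 fun _ _ => ENNReal.ofReal_ne_top)
  have := (Finset.sum_eq_zero_iff.1 h) i (Finset.mem_univ i)
  simp at this
  exact hi this

lemma weight_smul {ι : Type*} [Fintype ι] (v : ι → ℝ) (i : ι) {t : ℝ} (ht : 0 < t) :
    weight (t • v) i = weight v i := by
  simp only [weight, Pi.smul_apply, smul_eq_mul, abs_mul, abs_of_pos ht, ENNReal.ofReal_mul ht.le]
  rw [← Finset.mul_sum, ENNReal.mul_div_mul_left _ _ (by simpa using ht) ENNReal.ofReal_ne_top]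

/-- The tail measure on the block `I`. -/
noncomputable def blockMeasure (α : ℝ) (Q : Measure (Field d)) (I : Finset (Fin d → ℤ)) :
    Measure (I → ℝ) :=
  ∑ i : I, ((originMeasure α Q).withDensity
    fun x => weight (I.restrict (shift (-(i : Fin d → ℤ)) x)) i).map
      fun x => I.restrict (shift (-(i : Fin d → ℤ)) x)

variable {I J : Finset (Fin d → ℤ)}

lemma lintegral_blockMeasure {h : (I → ℝ) → ℝ≥0∞} (hh : Measurable h) :
    ∫⁻ v, h v ∂(blockMeasure α Q I) = ∑ i : I, ∫⁻ x,
      weight (I.restrict (shift (-(i : Fin d → ℤ)) x)) i *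
        h (I.restrict (shift (-(i : Fin d → ℤ)) x)) ∂(originMeasure α Q) := by
  rw [blockMeasure, lintegral_finsetSum_measure]
  refine Finset.sum_congr rfl fun i _ => ?_
  rw [lintegral_map hh (by fun_prop), lintegral_withDensity_eq_lintegral_mul _ (by fun_prop)
    (by fun_prop)]
  rfl

/-- Shift invariance moves the term of each `j` to the base point `i`: its integrand vanishes where
`v_i = 0` by `h0` and where `v_j = 0` by the weight. At a common base point the weights add up to
one. -/
lemma IsTailLaw.lintegral_blockMeasure_of_coord (hQ : IsTailLaw α Q) (i : I)
    {h : (I → ℝ) → ℝ≥0∞} (hh : Measurable h) (h0 : ∀ v, v i = 0 → h v = 0) :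
    ∫⁻ v, h v ∂(blockMeasure α Q I) =
      ∫⁻ x, h (I.restrict (shift (-(i : Fin d → ℤ)) x)) ∂(originMeasure α Q) := by
  rw [lintegral_blockMeasure hh]
  have h1 : ∀ j : I, ∫⁻ x, weight (I.restrict (shift (-(j : Fin d → ℤ)) x)) j *
        h (I.restrict (shift (-(j : Fin d → ℤ)) x)) ∂(originMeasure α Q) =
      ∫⁻ x, weight (I.restrict (shift (-(i : Fin d → ℤ)) x)) j *
        h (I.restrict (shift (-(i : Fin d → ℤ)) x)) ∂(originMeasure α Q) := by
    intro j
    rw [← hQ.lintegral_shift ((i : Fin d → ℤ) - j) (h := fun x =>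
      weight (I.restrict (shift (-(i : Fin d → ℤ)) x)) j *
        h (I.restrict (shift (-(i : Fin d → ℤ)) x))) (by fun_prop)]
    · refine lintegral_congr fun x => ?_
      rw [shift_shift]
      have : -(i : Fin d → ℤ) + (i - j) = -j := by abel
      rw [this]
    · intro x hx
      rw [h0 _ (by simpa [Finset.restrict] using hx), mul_zero]
    · intro x hx
      rw [weight_eq_zero (by simpa [Finset.restrict, sub_eq_add_neg, add_comm] using hx), zero_mul]
  simp_rw [h1]
  rw [← lintegral_finsetSum _ (fun j _ => by fun_prop)]
  refine lintegral_congr_ae ?_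
  filter_upwards [hQ.ae_originMeasure] with x hx
  rw [← Finset.sum_mul, sum_weight, one_mul]
  intro h
  have := congrFun h i
  simp [Finset.restrict] at this
  exact hx this

/-- The tail measures of a block and of a translate of a larger block agree off the origin. -/
lemma IsTailLaw.lintegral_blockMeasure_comp (hQ : IsTailLaw α Q) (k : Fin d → ℤ) (f : J → I)
    (hf : ∀ j : J, (f j : Fin d → ℤ) = j + k) {h : (J → ℝ) → ℝ≥0∞} (hh : Measurable h)
    (h0 : h 0 = 0) :
    ∫⁻ v, h v ∂(blockMeasure α Q J) = ∫⁻ v, h (v ∘ f) ∂(blockMeasure α Q I) := by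
  have hfm : Measurable fun v : I → ℝ => v ∘ f :=
    measurable_pi_lambda _ fun j => measurable_pi_apply (f j)
  -- The weights cut `h` into pieces that vanish where one coordinate does, and such pieces have a
  -- representation by `originMeasure` independent of the block.
  have hdec : ∀ v, h v = ∑ j : J, weight v j * h v := by
    intro v
    by_cases hv : v = 0
    · simp [hv, h0]
    · rw [← Finset.sum_mul, sum_weight hv, one_mul]
  have hmj : ∀ j : J, Measurable fun v : J → ℝ => weight v j * h v := fun j => by fun_prop
  have hmf : ∀ j : J, Measurable fun v : I → ℝ => weight (v ∘ f) j * h (v ∘ f) :=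
    fun j => (hmj j).comp hfm
  calc ∫⁻ v, h v ∂(blockMeasure α Q J)
      = ∑ j : J, ∫⁻ v, weight v j * h v ∂(blockMeasure α Q J) := by
        rw [← lintegral_finsetSum _ fun j _ => hmj j]
        exact lintegral_congr hdec
    _ = ∑ j : J, ∫⁻ v, weight (v ∘ f) j * h (v ∘ f) ∂(blockMeasure α Q I) := by
        refine Finset.sum_congr rfl fun j _ => ?_
        rw [hQ.lintegral_blockMeasure_of_coord j (hmj j) fun v hv => by
            rw [weight_eq_zero hv, zero_mul],
          hQ.lintegral_blockMeasure_of_coord (f j) (hmf j) fun v hv => by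
            rw [weight_eq_zero (by exact hv), zero_mul]]
        refine lintegral_congr fun x => ?_
        have : I.restrict (shift (-(f j : Fin d → ℤ)) x) ∘ f =
            J.restrict (shift (-(j : Fin d → ℤ)) x) := by
          funext j'
          simp only [Function.comp_apply, Finset.restrict, shift_apply, hf]
          congr 1
          abel
        simp only [Function.comp_def] at this ⊢
        rw [this]
    _ = ∫⁻ v, h (v ∘ f) ∂(blockMeasure α Q I) := by
        rw [← lintegral_finsetSum _ fun j _ => hmf j]
        exact (lintegral_congr fun v => hdec (v ∘ f)).symm

lemma IsTailLaw.lintegral_blockMeasure_smul (hQ : IsTailLaw α Q) {t : ℝ} (ht : 0 < t)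
    {h : (I → ℝ) → ℝ≥0∞} (hh : Measurable h) :
    ∫⁻ v, h (t • v) ∂(blockMeasure α Q I) =
      ENNReal.ofReal (t ^ α) * ∫⁻ v, h v ∂(blockMeasure α Q I) := by
  rw [lintegral_blockMeasure hh, lintegral_blockMeasure (by fun_prop), Finset.mul_sum]
  refine Finset.sum_congr rfl fun i _ => ?_
  rw [← hQ.lintegral_originMeasure_smul ht (by fun_prop)]
  refine lintegral_congr fun x => ?_
  have : I.restrict (shift (-(i : Fin d → ℤ)) (t • x)) =
      t • I.restrict (shift (-(i : Fin d → ℤ)) x) := rfl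
  rw [this, weight_smul _ _ ht]

lemma IsTailLaw.map_smul_blockMeasure (hQ : IsTailLaw α Q) {t : ℝ} (ht : 0 < t) :
    (blockMeasure α Q I).map (fun v => t • v) = ENNReal.ofReal (t ^ α) • blockMeasure α Q I := by
  refine Measure.ext_of_lintegral _ fun h hh => ?_
  rw [lintegral_map hh (by fun_prop), hQ.lintegral_blockMeasure_smul ht hh, lintegral_smul_measure,
    smul_eq_mul]

lemma IsTailLaw.blockMeasure_zero (hQ : IsTailLaw α Q) : blockMeasure α Q I {0} = 0 := by
  have h : Measurable (({0} : Set (I → ℝ)).indicator fun _ => (1 : ℝ≥0∞)) :=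
    measurable_const.indicator (measurableSet_singleton 0)
  rw [← one_mul (blockMeasure α Q I {0}), ← lintegral_indicator_const (measurableSet_singleton 0),
    lintegral_blockMeasure h]
  refine Finset.sum_eq_zero fun i _ => ?_
  rw [lintegral_eq_zero_iff (by fun_prop)]
  filter_upwards [hQ.ae_originMeasure] with x hx
  rw [Set.indicator_of_notMem, mul_zero]; · rfl
  intro h0
  have := congrFun (Set.mem_singleton_iff.1 h0) i
  simp [Finset.restrict] at this
  exact hx this

lemma IsTailLaw.blockMeasure_restrict (hQ : IsTailLaw α Q) (hI : (0 : Fin d → ℤ) ∈ I) :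
    (blockMeasure α Q I).restrict {v | 1 < |v ⟨0, hI⟩|} = Q.map I.restrict := by
  have hm : MeasurableSet {v : I → ℝ | 1 < |v ⟨0, hI⟩|} :=
    measurableSet_lt measurable_const (by fun_prop)
  refine Measure.ext_of_lintegral _ fun h hh => ?_
  rw [lintegral_map hh (by fun_prop), ← lintegral_indicator hm]
  conv_rhs => rw [← hQ.restrict_originMeasure, ← lintegral_indicator (measurableSet_exceeds 1 0)]
  rw [hQ.lintegral_blockMeasure_of_coord ⟨0, hI⟩ (hh.indicator hm)]
  · refine lintegral_congr fun x => ?_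
    simp only [neg_zero, shift_zero]
    rfl
  · intro v hv
    rw [Set.indicator_of_notMem]
    simp [hv]

lemma IsTailLaw.blockMeasure_coord (hQ : IsTailLaw α Q) (i : I) {s : ℝ} (hs : 0 < s) :
    blockMeasure α Q I {v | s < |v i|} = ENNReal.ofReal (s ^ (-α)) := by
  have hm : MeasurableSet {v : I → ℝ | s < |v i|} :=
    measurableSet_lt measurable_const (by fun_prop)
  rw [← hQ.originMeasure_exceeds hs, ← one_mul (blockMeasure α Q I _),
    ← lintegral_indicator_const hm, hQ.lintegral_blockMeasure_of_coord i
      (measurable_const.indicator hm), ← one_mul (originMeasure α Q _),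
    ← lintegral_indicator_const (measurableSet_exceeds s 0)]
  · refine lintegral_congr fun x => ?_
    simp [Set.indicator_apply, Finset.restrict]
  · intro v hv
    rw [Set.indicator_of_notMem]
    simp [hv, hs.le]

lemma setOf_lt_norm_eq {ι : Type*} [Fintype ι] {s : ℝ} (hs : 0 ≤ s) :
    {v : ι → ℝ | s < ‖v‖} = ⋃ i, {v | s < |v i|} := by
  ext v
  rw [Set.mem_iUnion]
  change s < ‖v‖ ↔ ∃ i, s < |v i|
  rw [← not_iff_not]
  push Not
  simp only [pi_norm_le_iff_of_nonneg hs, Real.norm_eq_abs]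

lemma IsTailLaw.blockMeasure_norm_lt_top (hQ : IsTailLaw α Q) {s : ℝ} (hs : 0 < s) :
    blockMeasure α Q I {v | s < ‖v‖} < ∞ := by
  rw [setOf_lt_norm_eq hs.le]
  refine (measure_iUnion_fintype_le _ _).trans_lt (ENNReal.sum_lt_top.2 fun i _ => ?_)
  rw [hQ.blockMeasure_coord i hs]
  exact ENNReal.ofReal_lt_top

lemma IsTailLaw.blockMeasure_norm (hQ : IsTailLaw α Q) {s : ℝ} (hs : 0 < s) :
    (blockMeasure α Q I).real {v | s < ‖v‖} =
      (blockMeasure α Q I).real {v | 1 < ‖v‖} * s ^ (-α) := by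
  have hm : MeasurableSet {v : I → ℝ | 1 < ‖v‖} :=
    measurableSet_lt measurable_const measurable_norm
  have h := congrArg (fun μ => μ {v | 1 < ‖v‖}) (hQ.map_smul_blockMeasure (I := I) (inv_pos.2 hs))
  simp only [Measure.map_apply (measurable_const_smul s⁻¹) hm, Measure.smul_apply, smul_eq_mul,
    Real.inv_rpow hs.le, ← Real.rpow_neg hs.le] at h
  have e : (fun v : I → ℝ => s⁻¹ • v) ⁻¹' {v | 1 < ‖v‖} = {v | s < ‖v‖} := by
    ext v
    simp only [Set.mem_preimage, Set.mem_ofPred_eq, norm_smul, norm_inv, Real.norm_of_nonneg hs.le]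
    rw [lt_inv_mul_iff₀ hs, mul_one]
  rw [e] at h
  rw [measureReal_def, h, ENNReal.toReal_mul, ENNReal.toReal_ofReal (by positivity), mul_comm]
  rfl

lemma IsTailLaw.blockMeasure_norm_pos (hQ : IsTailLaw α Q) (hI : I.Nonempty) :
    0 < (blockMeasure α Q I).real {v | 1 < ‖v‖} := by
  obtain ⟨i, hi⟩ := hI
  refine ENNReal.toReal_pos (fun h => ?_) (hQ.blockMeasure_norm_lt_top one_pos).ne
  have h1 := hQ.blockMeasure_coord ⟨i, hi⟩ one_pos
  rw [Real.one_rpow, ENNReal.ofReal_one] at h1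
  rw [setOf_lt_norm_eq zero_le_one, measure_iUnion_null_iff] at h
  rw [h ⟨i, hi⟩] at h1
  exact zero_ne_one h1

end

/-! ### Kolmogorov extension -/

open Preorder in
/-- **Kolmogorov extension theorem** for sequences of real random variables. -/
theorem exists_isProjectiveLimit_nat (P : ∀ J : Finset ℕ, Measure (J → ℝ))
    [∀ J, IsProbabilityMeasure (P J)]
    (hP : IsProjectiveMeasureFamily (α := fun _ : ℕ => ℝ) P) :
    ∃ μ : Measure (ℕ → ℝ), IsProjectiveLimit μ P := by
  classical
  let last : ∀ n : ℕ, (Finset.Iic (n + 1) → ℝ) → ℝ := fun n x => x ⟨n + 1, by simp⟩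
  let init : ∀ n : ℕ, (Finset.Iic (n + 1) → ℝ) → (Finset.Iic n → ℝ) := fun n =>
    frestrictLe₂ (π := fun _ : ℕ => ℝ) n.le_succ
  have hinit : ∀ n, Measurable (init n) := fun n => measurable_frestrictLe₂ _
  have hlast : ∀ n, Measurable (last n) := fun n => measurable_pi_apply _
  -- The law is generated coordinate by coordinate: `κ n` is the conditional law of coordinate `n +
  -- 1` given coordinates `0, …, n`.
  let κ : ∀ n : ℕ, Kernel (∀ _ : Finset.Iic n, ℝ) ℝ := fun n =>
    condDistrib (last n) (init n) (P (Finset.Iic (n + 1)))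
  let μ₀ : Measure ℝ := (P (Finset.Iic 0)).map (MeasurableEquiv.piUnique fun _ : Finset.Iic 0 => ℝ)
  have : IsProbabilityMeasure μ₀ := Measure.isProbabilityMeasure_map (by fun_prop)
  have hκ : ∀ n, IsMarkovKernel (κ n) := fun n => by dsimp only [κ]; infer_instance
  let M : Measure (ℕ → ℝ) := Kernel.trajMeasure (X := fun _ => ℝ) μ₀ κ
  refine ⟨M, (isProjectiveLimit_nat_iff hP M).2 fun n => ?_⟩
  induction n with
  | zero =>
    dsimp only [M]
    rw [Kernel.trajMeasure, Measure.map_comp _ _ (by fun_prop), Kernel.traj_map_frestrictLe,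
      Kernel.partialTraj_self, Measure.id_comp]
    change Measure.map _ ((P (Finset.Iic 0)).map _) = _
    rw [Measure.map_map (by fun_prop) (by fun_prop)]
    convert Measure.map_id using 2
    funext x
    exact (MeasurableEquiv.piUnique fun _ : Finset.Iic 0 => ℝ).symm_apply_apply x
  | succ a ih =>
    have hi : (P (Finset.Iic (a + 1))).map (init a) = P (Finset.Iic a) :=
      (hP (Finset.Iic (a + 1)) (Finset.Iic a) (Finset.Iic_subset_Iic.2 a.le_succ)).symm
    have h1 : M.map (fun x => (frestrictLe (π := fun _ : ℕ => ℝ) a x, x (a + 1))) =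
        (P (Finset.Iic (a + 1))).map fun x => (init a x, last a x) := by
      rw [← Kernel.map_frestrictLe_trajMeasure_compProd_eq_map_trajMeasure, ih, ← hi]
      exact compProd_map_condDistrib (hlast a).aemeasurable
    let G : (Finset.Iic a → ℝ) × ℝ → (Finset.Iic (a + 1) → ℝ) := fun p i =>
      if h : (i : ℕ) ≤ a then p.1 ⟨i, Finset.mem_Iic.2 h⟩ else p.2
    have hG : Measurable G := measurable_pi_lambda _ fun i => by
      by_cases h : (i : ℕ) ≤ a <;> simp only [G, h, dite_true, dite_false] <;> fun_prop
    have h2 := congrArg (fun μ => μ.map G) h1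
    rw [Measure.map_map hG (by fun_prop), Measure.map_map hG ((hinit a).prodMk (hlast a))] at h2
    have hcase : ∀ i : Finset.Iic (a + 1), ¬ (i : ℕ) ≤ a → (i : ℕ) = a + 1 := fun i h => by
      have := Finset.mem_Iic.1 i.2
      omega
    have e1 : (G ∘ fun x : ℕ → ℝ => (frestrictLe (π := fun _ : ℕ => ℝ) a x, x (a + 1))) =
        frestrictLe (π := fun _ : ℕ => ℝ) (a + 1) := by
      funext x i
      by_cases h : (i : ℕ) ≤ a
      · simp [G, h]
      · simp [G, hcase i h]
    have e2 : (G ∘ fun x => (init a x, last a x)) = id := by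
      funext x i
      by_cases h : (i : ℕ) ≤ a
      · simp [G, h, init]
      · simp only [G, Function.comp_apply, h, dite_false, last, id]
        congr 1
        exact Subtype.ext (hcase i h).symm
    rwa [e1, e2, Measure.map_id] at h2

/-- **Kolmogorov extension theorem** for countable families of real random variables. -/
theorem exists_isProjectiveLimit {ι : Type*} [Countable ι] [Nonempty ι]
    (P : ∀ J : Finset ι, Measure (J → ℝ)) [∀ J, IsProbabilityMeasure (P J)]
    (hP : IsProjectiveMeasureFamily (α := fun _ : ι => ℝ) P) :
    ∃ μ : Measure (ι → ℝ), IsProjectiveLimit μ P := by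
  classical
  obtain ⟨s, hs⟩ := exists_surjective_nat ι
  obtain ⟨e, he⟩ := hs.hasRightInverse
  -- The index set is enumerated by a surjection, possibly with repetitions; repeated indices carry
  -- copies of the same coordinate, and the section `e` reads each coordinate once.
  let pull : ∀ J : Finset ℕ, (J.image s → ℝ) → (J → ℝ) := fun J x n =>
    x ⟨s n, Finset.mem_image_of_mem s n.2⟩
  have hpull : ∀ J, Measurable (pull J) := fun J =>
    measurable_pi_lambda _ fun n => measurable_pi_apply _
  let P' : ∀ J : Finset ℕ, Measure (J → ℝ) := fun J => (P (J.image s)).map (pull J)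
  have : ∀ J, IsProbabilityMeasure (P' J) := fun J =>
    Measure.isProbabilityMeasure_map (hpull J).aemeasurable
  have hP' : IsProjectiveMeasureFamily (α := fun _ : ℕ => ℝ) P' := by
    intro I J hJI
    have hr : Measurable (Finset.restrict₂ (π := fun _ : ℕ => ℝ) hJI) :=
      Finset.measurable_restrict₂ hJI
    simp only [P']
    rw [hP _ _ (Finset.image_subset_image hJI), Measure.map_map (hpull J)
      (Finset.measurable_restrict₂ _), Measure.map_map hr (hpull I)]
    rfl
  obtain ⟨ν, hν⟩ := exists_isProjectiveLimit_nat P' hP'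
  have hm : Measurable fun (x : ℕ → ℝ) i => x (e i) :=
    measurable_pi_lambda _ fun i => measurable_pi_apply _
  refine ⟨ν.map fun x i => x (e i), fun I => ?_⟩
  let pick : (I.image e → ℝ) → (I → ℝ) := fun x i => x ⟨e i, Finset.mem_image_of_mem e i.2⟩
  have hpick : Measurable pick := measurable_pi_lambda _ fun i => measurable_pi_apply _
  rw [Measure.map_map (by fun_prop) hm]
  have e1 : (I.restrict ∘ fun (x : ℕ → ℝ) i => x (e i)) =
      pick ∘ (I.image e).restrict (π := fun _ : ℕ => ℝ) := rfl
  rw [e1, ← Measure.map_map hpick (by fun_prop), hν]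
  simp only [P']
  have hsub : I ⊆ (I.image e).image s := fun i hi =>
    Finset.mem_image.2 ⟨e i, Finset.mem_image_of_mem e hi, he i⟩
  rw [Measure.map_map hpick (hpull _), hP _ _ hsub]
  congr 1
  funext x i
  simp only [Function.comp_apply, pick, pull, Finset.restrict₂]
  congr 1
  exact Subtype.ext (he i)

/-! ### The truncated intensity -/

section Trunc

variable {ι : Type*}

/-- Replaces the coordinates of modulus at most `1` by `0`. -/
noncomputable def trunc (v : ι → ℝ) : ι → ℝ := fun i => if 1 < |v i| then v i else 0

@[fun_prop]
lemma measurable_trunc : Measurable (trunc : (ι → ℝ) → ι → ℝ) :=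
  measurable_pi_lambda _ fun i => Measurable.ite
    (measurableSet_lt measurable_const (by fun_prop)) (by fun_prop) measurable_const

@[simp]
lemma trunc_zero : trunc (0 : ι → ℝ) = 0 := by funext i; simp [trunc]

variable [Fintype ι]

lemma norm_trunc_le (v : ι → ℝ) : ‖trunc v‖ ≤ ‖v‖ := by
  refine (pi_norm_le_iff_of_nonneg (norm_nonneg v)).2 fun i => ?_
  simp only [trunc]
  split_ifs
  · exact norm_le_pi_norm v i
  · simp

lemma norm_trunc_sub_le (v : ι → ℝ) : ‖trunc v - v‖ ≤ 1 := by
  refine (pi_norm_le_iff_of_nonneg zero_le_one).2 fun i => ?_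
  simp only [trunc, Pi.sub_apply]
  split_ifs with h
  · simp
  · rw [zero_sub, norm_neg]
    exact not_lt.1 h

lemma lt_norm_trunc_iff {u : ℝ} (hu : 1 ≤ u) (v : ι → ℝ) : u < ‖trunc v‖ ↔ u < ‖v‖ := by
  refine ⟨fun h => h.trans_le (norm_trunc_le v), fun h => ?_⟩
  have hu0 : 0 ≤ u := zero_le_one.trans hu
  have h' : v ∈ {v : ι → ℝ | u < ‖v‖} := h
  rw [setOf_lt_norm_eq hu0, Set.mem_iUnion] at h'
  obtain ⟨i, hi⟩ := h'
  have hi : u < |v i| := hi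
  have : u < ‖trunc v i‖ := by
    rw [trunc, if_pos (hu.trans_lt hi)]; exact hi
  exact this.trans_le (norm_le_pi_norm _ i)

lemma trunc_eq_zero_of_norm_le {v : ι → ℝ} (h : ‖v‖ ≤ 1) : trunc v = 0 := by
  funext i
  exact if_neg (not_lt.2 ((norm_le_pi_norm v i).trans h))

end Trunc

variable {α : ℝ} {Q : Measure (Field d)} {I J : Finset (Fin d → ℤ)}

/-- The intensity, on the block `I`, of the points that enter the construction of the field. -/
noncomputable def intensity (α : ℝ) (Q : Measure (Field d)) (I : Finset (Fin d → ℤ)) :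
    Measure (I → ℝ) :=
  ((blockMeasure α Q I).restrict {v | 1 < ‖v‖}).map trunc

lemma measurableSet_lt_norm {ι : Type*} [Fintype ι] (u : ℝ) :
    MeasurableSet {v : ι → ℝ | u < ‖v‖} := measurableSet_lt measurable_const measurable_norm

lemma IsTailLaw.isFiniteMeasure_intensity (hQ : IsTailLaw α Q) (I : Finset (Fin d → ℤ)) :
    IsFiniteMeasure (intensity α Q I) := by
  have : IsFiniteMeasure ((blockMeasure α Q I).restrict {v | 1 < ‖v‖}) :=
    ⟨by rw [Measure.restrict_apply_univ]; exact hQ.blockMeasure_norm_lt_top one_pos⟩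
  unfold intensity
  infer_instance

lemma lintegral_intensity {h : (I → ℝ) → ℝ≥0∞} (hh : Measurable h) (h0 : h 0 = 0) :
    ∫⁻ v, h v ∂(intensity α Q I) = ∫⁻ v, h (trunc v) ∂(blockMeasure α Q I) := by
  rw [intensity, lintegral_map hh (by fun_prop), setLIntegral_eq_of_support_subset]
  intro v hv
  by_contra hc
  refine hv ?_
  change h (trunc v) = 0
  rw [trunc_eq_zero_of_norm_le (not_lt.1 hc), h0]

/-- Truncation makes the intensities consistent: a point large on `I` but nowhere above `1` on `J`
restricts to exactly `0`, so only an atom there is added, to which the compound law is insensitive.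
-/
lemma IsTailLaw.map_comp_intensity (hQ : IsTailLaw α Q) (k : Fin d → ℤ) (f : J → I)
    (hf : ∀ j : J, (f j : Fin d → ℤ) = j + k) :
    ∃ c : ℝ≥0∞, c ≠ ∞ ∧
      (intensity α Q I).map (fun v => v ∘ f) = intensity α Q J + c • Measure.dirac 0 := by
  have := hQ.isFiniteMeasure_intensity
  have hfm : Measurable fun v : I → ℝ => v ∘ f :=
    measurable_pi_lambda _ fun j => measurable_pi_apply (f j)
  have h0 : MeasurableSet ({0} : Set (J → ℝ)) := measurableSet_singleton 0
  have hJ0 : intensity α Q J {0} = 0 := by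
    rw [intensity, Measure.map_apply measurable_trunc h0,
      Measure.restrict_apply (measurable_trunc h0)]
    convert measure_empty (μ := blockMeasure α Q J)
    refine Set.eq_empty_of_forall_notMem fun v hv => ?_
    have h1 : trunc v = 0 := hv.1
    have h2 := (lt_norm_trunc_iff le_rfl v).2 hv.2
    rw [h1, norm_zero] at h2
    linarith
  refine ⟨(intensity α Q I).map (fun v => v ∘ f) {0}, measure_ne_top _ _, ?_⟩
  ext A hA
  have hdiff : ∀ μ : Measure (J → ℝ), μ A = μ (A \ {0}) + μ (A ∩ {0}) := fun μ => by
    rw [add_comm]; exact (measure_inter_add_sdiff A h0).symm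
  have hA0 : MeasurableSet (A \ {0}) := hA.diff h0
  have e1 : (intensity α Q I).map (fun v => v ∘ f) (A \ {0}) = intensity α Q J (A \ {0}) := by
    have hm : Measurable ((A \ {0}).indicator fun _ : J → ℝ => (1 : ℝ≥0∞)) :=
      measurable_const.indicator hA0
    have hz : (A \ {0}).indicator (fun _ : J → ℝ => (1 : ℝ≥0∞)) 0 = 0 :=
      Set.indicator_of_notMem (by simp) _
    rw [← one_mul (Measure.map _ _ _), ← lintegral_indicator_const hA0, lintegral_map hm hfm,
      ← one_mul (intensity α Q J _), ← lintegral_indicator_const hA0, lintegral_intensity hm hz,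
      lintegral_intensity (h := fun v => (A \ {0}).indicator (fun _ : J → ℝ => (1 : ℝ≥0∞)) (v ∘ f))
        (hm.comp hfm) hz,
      hQ.lintegral_blockMeasure_comp k f hf
        (h := fun v => (A \ {0}).indicator (fun _ : J → ℝ => (1 : ℝ≥0∞)) (trunc v))
        (hm.comp measurable_trunc) (by simp)]
    rfl
  rw [hdiff, hdiff (intensity α Q J + _), e1, Measure.add_apply, Measure.add_apply,
    Measure.smul_apply, Measure.smul_apply, Measure.dirac_apply' _ hA0,
    Measure.dirac_apply' _ (hA.inter h0), Set.indicator_of_notMem (by simp), smul_zero, add_zero,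
    measure_mono_null Set.inter_subset_right hJ0, zero_add]
  congr 1
  by_cases hA' : (0 : J → ℝ) ∈ A
  · rw [Set.indicator_of_mem (by simpa using hA'), Pi.one_apply, smul_eq_mul, mul_one,
      Set.inter_eq_right.2 (by simpa using hA')]
  · rw [Set.indicator_of_notMem (by simpa using hA'), smul_zero,
      Set.inter_singleton_eq_empty.2 hA', measure_empty]

/-- For `k = 0` this is Kolmogorov consistency; for a translate of a block it is stationarity. -/
lemma IsTailLaw.map_comp_compound (hQ : IsTailLaw α Q) (k : Fin d → ℤ) (f : J → I)
    (hf : ∀ j : J, (f j : Fin d → ℤ) = j + k) :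
    (compound (intensity α Q I)).map (fun v => v ∘ f) = compound (intensity α Q J) := by
  have := hQ.isFiniteMeasure_intensity
  obtain ⟨c, hc, h⟩ := hQ.map_comp_intensity k f hf
  exact (isCompound_compound.map_comp f hc h).eq_compound

lemma IsTailLaw.intensity_norm (hQ : IsTailLaw α Q) {u : ℝ} (hu : 1 ≤ u) :
    (intensity α Q I).real {v | u < ‖v‖} =
      (blockMeasure α Q I).real {v | 1 < ‖v‖} * u ^ (-α) := by
  rw [← hQ.blockMeasure_norm (zero_lt_one.trans_le hu), measureReal_def, measureReal_def, intensity,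
    Measure.map_apply measurable_trunc (measurableSet_lt_norm u),
    Measure.restrict_apply (measurable_trunc (measurableSet_lt_norm u))]
  congr 2
  ext v
  change (u < ‖trunc v‖ ∧ 1 < ‖v‖) ↔ u < ‖v‖
  rw [lt_norm_trunc_iff hu]
  exact ⟨fun h => h.1, fun h => ⟨h, hu.trans_lt h⟩⟩

lemma IsTailLaw.intensity_norm_le (hQ : IsTailLaw α Q) {u : ℝ} (hu : 0 < u) :
    (intensity α Q I).real {v | u < ‖v‖} ≤
      (blockMeasure α Q I).real {v | 1 < ‖v‖} * u ^ (-α) := by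
  rw [← hQ.blockMeasure_norm hu, measureReal_def, measureReal_def, intensity,
    Measure.map_apply measurable_trunc (measurableSet_lt_norm u),
    Measure.restrict_apply (measurable_trunc (measurableSet_lt_norm u))]
  refine ENNReal.toReal_mono (hQ.blockMeasure_norm_lt_top hu).ne (measure_mono fun v hv => ?_)
  have hv : u < ‖trunc v‖ := hv.1
  exact hv.trans_le (norm_trunc_le v)

/-! ### Tail asymptotics of the finite-dimensional laws -/

section Asymptotics

variable {g : (I → ℝ) → ℝ} {M ε : ℝ}

/-- Homogeneity absorbs `u^α` and leaves `g` evaluated at `u⁻¹ • trunc (u • v)`, within `1/u` of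
`v`. Domination holds because truncation does not increase the norm and `g` vanishes near `0`. -/
lemma IsTailLaw.tendsto_intensity (hQ : IsTailLaw α Q) (hg : Continuous g) (hM : ∀ x, |g x| ≤ M)
    (hε : 0 < ε) (hg0 : ∀ x, ‖x‖ < ε → g x = 0) :
    Tendsto (fun u : ℝ => u ^ α * ∫ z, g (u⁻¹ • z) ∂(intensity α Q I)) atTop
      (𝓝 (∫ v, g v ∂(blockMeasure α Q I))) := by
  have h0 : g 0 = 0 := hg0 0 (by simpa using hε)
  have key : ∀ u : ℝ, 0 < u → u ^ α * ∫ z, g (u⁻¹ • z) ∂(intensity α Q I) =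
      ∫ v, g (u⁻¹ • trunc (u • v)) ∂(blockMeasure α Q I) := by
    intro u hu
    have hm : Measurable fun z : I → ℝ => g (u⁻¹ • z) :=
      hg.measurable.comp (measurable_const_smul _)
    rw [intensity, integral_map (by fun_prop) hm.aestronglyMeasurable,
      setIntegral_eq_integral_of_forall_compl_eq_zero fun v hv => by
        rw [trunc_eq_zero_of_norm_le (not_lt.1 hv), smul_zero, h0]]
    have h1 := congrArg (fun μ => ∫ v, g (u⁻¹ • trunc v) ∂μ) (hQ.map_smul_blockMeasure (I := I) hu)
    have hm' : Measurable fun v : I → ℝ => g (u⁻¹ • trunc v) := hm.comp measurable_trunc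
    rw [integral_map (by fun_prop) hm'.aestronglyMeasurable, integral_smul_measure, ENNReal.toReal_ofReal (by positivity), smul_eq_mul] at h1
    exact h1.symm
  have hlim : Tendsto (fun u : ℝ => ∫ v, g (u⁻¹ • trunc (u • v)) ∂(blockMeasure α Q I)) atTop
      (𝓝 (∫ v, g v ∂(blockMeasure α Q I))) := by
    refine tendsto_integral_filter_of_dominated_convergence
      ({v : I → ℝ | ε / 2 < ‖v‖}.indicator fun _ => M) ?_ ?_ ?_ ?_
    · exact Eventually.of_forall fun u => (hg.measurable.comp ((measurable_const_smul _).comp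
        (measurable_trunc.comp (measurable_const_smul u)))).aestronglyMeasurable
    · filter_upwards [eventually_gt_atTop 0] with u hu
      refine ae_of_all _ fun v => ?_
      by_cases hv : ε / 2 < ‖v‖
      · rw [Set.indicator_of_mem (show v ∈ {v : I → ℝ | ε / 2 < ‖v‖} from hv)]
        exact hM _
      · rw [Set.indicator_of_notMem (show v ∉ {v : I → ℝ | ε / 2 < ‖v‖} from hv), hg0, norm_zero]
        calc ‖u⁻¹ • trunc (u • v)‖ ≤ u⁻¹ * ‖u • v‖ := by
              rw [norm_smul, norm_inv, Real.norm_of_nonneg hu.le]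
              exact mul_le_mul_of_nonneg_left (norm_trunc_le _) (inv_nonneg.2 hu.le)
          _ = ‖v‖ := by
              rw [norm_smul, Real.norm_of_nonneg hu.le, inv_mul_cancel_left₀ hu.ne']
          _ < ε := by linarith
    · rw [integrable_indicator_iff (measurableSet_lt_norm _)]
      exact integrableOn_const (hQ.blockMeasure_norm_lt_top (by positivity)).ne
    · refine ae_of_all _ fun v => (hg.tendsto v).comp ?_
      rw [tendsto_iff_norm_sub_tendsto_zero]
      refine squeeze_zero' (Eventually.of_forall fun _ => norm_nonneg _) ?_ tendsto_inv_atTop_zero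
      filter_upwards [eventually_gt_atTop 0] with u hu
      have e : u⁻¹ • trunc (u • v) - v = u⁻¹ • (trunc (u • v) - u • v) := by
        rw [smul_sub, inv_smul_smul₀ hu.ne']
      rw [e, norm_smul, norm_inv, Real.norm_of_nonneg hu.le]
      exact mul_le_of_le_one_right (inv_nonneg.2 hu.le) (norm_trunc_sub_le _)
  refine hlim.congr' ?_
  filter_upwards [eventually_gt_atTop 0] with u hu using (key u hu).symm

lemma IsTailLaw.tendsto_compound (hQ : IsTailLaw α Q) (hα : 0 < α) (hg : Continuous g)
    (hM : ∀ x, |g x| ≤ M) (hε : 0 < ε) (hg0 : ∀ x, ‖x‖ < ε → g x = 0) :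
    Tendsto (fun u : ℝ => u ^ α * ∫ z, g (u⁻¹ • z) ∂(compound (intensity α Q I))) atTop
      (𝓝 (∫ v, g v ∂(blockMeasure α Q I))) := by
  have := hQ.isFiniteMeasure_intensity
  have h := (isCompound_compound (m := intensity α Q I)).tendsto_sub hα
    (fun v hv => hQ.intensity_norm_le hv) hg hM hε hg0
  simpa [mul_sub] using h.add (hQ.tendsto_intensity hg hM hε hg0)

lemma IsTailLaw.compound_norm (hQ : IsTailLaw α Q) {u : ℝ} (hu : 1 ≤ u) :
    (compound (intensity α Q I)).real {v | u < ‖v‖} =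
      (blockMeasure α Q I).real {v | 1 < ‖v‖} * u ^ (-α) /
        (1 + (blockMeasure α Q I).real {v | 1 < ‖v‖} * u ^ (-α)) := by
  have := hQ.isFiniteMeasure_intensity
  rw [isCompound_compound.measureReal_norm_gt (zero_le_one.trans hu), hQ.intensity_norm hu]

lemma IsTailLaw.tendsto_compound_norm (hQ : IsTailLaw α Q) (hα : 0 < α) :
    Tendsto (fun u : ℝ => u ^ α * (compound (intensity α Q I)).real {v | u < ‖v‖}) atTop
      (𝓝 ((blockMeasure α Q I).real {v | 1 < ‖v‖})) := by
  set c := (blockMeasure α Q I).real {v | 1 < ‖v‖} with hc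
  have h1 : Tendsto (fun u : ℝ => c / (1 + c * u ^ (-α))) atTop (𝓝 (c / (1 + c * 0))) :=
    tendsto_const_nhds.div (((tendsto_rpow_neg_atTop hα).const_mul c).const_add 1) (by simp)
  rw [mul_zero, add_zero, div_one] at h1
  refine h1.congr' ?_
  filter_upwards [eventually_ge_atTop 1] with u hu
  have hu0 : 0 < u := zero_lt_one.trans_le hu
  have hun : u ^ α * u ^ (-α) = 1 := by rw [← Real.rpow_add hu0]; simp
  rw [hQ.compound_norm hu, ← hc, ← mul_div_assoc, mul_left_comm, hun, mul_one]

end Asymptotics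

/-! ### The stationary field and its tail process -/

section Construction

lemma integral_restrict {P' : Measure (Field d)} (I : Finset (Fin d → ℤ)) {g : (I → ℝ) → ℝ} (hg : Measurable g) :
    ∫ x, g (I.restrict x) ∂P' = ∫ v, g v ∂(P'.map I.restrict) :=
  (integral_map (by fun_prop) hg.aestronglyMeasurable).symm

lemma measureReal_restrict {P' : Measure (Field d)} (I : Finset (Fin d → ℤ)) {A : Set (I → ℝ)} (hA : MeasurableSet A) :
    P'.real {x | I.restrict x ∈ A} = (P'.map I.restrict).real A := by
  rw [measureReal_def, measureReal_def, Measure.map_apply (by fun_prop) hA]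
  rfl

variable {P' : Measure (Field d)}

lemma IsTailLaw.exists_fieldLaw (hQ : IsTailLaw α Q) :
    ∃ P' : Measure (Field d), IsProbabilityMeasure P' ∧
      ∀ I : Finset (Fin d → ℤ), P'.map I.restrict = compound (intensity α Q I) := by
  have := hQ.isFiniteMeasure_intensity
  have hprob : ∀ I, IsProbabilityMeasure (compound (intensity α Q I)) := fun I =>
    isCompound_compound.isProbabilityMeasure
  obtain ⟨P', hP'⟩ := exists_isProjectiveLimit (fun I => compound (intensity α Q I))
    fun I J hJI => (hQ.map_comp_compound 0 (fun j : J => (⟨j, hJI j.2⟩ : I)) fun j => by simp).symm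
  exact ⟨P', hP'.isProbabilityMeasure, hP'⟩

lemma IsTailLaw.isRegularlyVaryingField (hQ : IsTailLaw α Q) (hα : 0 < α)
    (hP' : ∀ I : Finset (Fin d → ℤ), P'.map I.restrict = compound (intensity α Q I)) :
    IsRegularlyVaryingField P' (fun x : Field d => x) α := by
  intro I hI
  set c := (blockMeasure α Q I).real {v | 1 < ‖v‖} with hc
  have hc0 : 0 < c := hQ.blockMeasure_norm_pos hI
  have hci : ENNReal.ofReal c⁻¹ ≠ 0 := by simpa using hc0
  have hnorm : ∀ u : ℝ, P'.real {x | u < ‖fun i : I => x i‖} =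
      (compound (intensity α Q I)).real {v | u < ‖v‖} := fun u => by
    rw [← hP' I]
    exact measureReal_restrict I (measurableSet_lt_norm u)
  -- The factor `c⁻¹` reflects the normalization by `P(‖V‖ > u)`, which is asymptotic to `c u^(-α)`.
  refine ⟨fun u => ?_, ENNReal.ofReal c⁻¹ • blockMeasure α Q I, ?_, ?_, ?_, ?_, ?_⟩
  · have h1 : 0 < P'.real {x | max u 1 < ‖fun i : I => x i‖} := by
      rw [hnorm, hQ.compound_norm (le_max_right u 1)]
      have : 0 < max u 1 := zero_lt_one.trans_le (le_max_right u 1)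
      positivity
    refine (ENNReal.toReal_pos_iff.1 h1).1.trans_le (measure_mono fun x hx => ?_)
    exact (le_max_left u 1).trans_lt hx
  · intro h
    have h1 := congrArg (fun μ => μ {v | 1 < ‖v‖}) h
    simp only [Measure.smul_apply, smul_eq_mul, Measure.coe_zero, Pi.zero_apply, mul_eq_zero,
      hci, false_or] at h1
    rw [hc, measureReal_def, h1] at hc0
    exact lt_irrefl _ hc0
  · rw [Measure.smul_apply, hQ.blockMeasure_zero, smul_zero]
  · intro ε hε
    rw [Measure.smul_apply, smul_eq_mul]
    refine ENNReal.mul_lt_top ENNReal.ofReal_lt_top (lt_of_le_of_lt (measure_mono fun v hv => ?_)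
      (hQ.blockMeasure_norm_lt_top (half_pos hε)))
    exact (half_lt_self hε).trans_le hv
  · intro t ht A hA
    have h1 := congrArg (fun μ => μ A) (hQ.map_smul_blockMeasure (I := I) ht)
    rw [Measure.map_apply (measurable_const_smul t) hA, Measure.smul_apply, smul_eq_mul] at h1
    rw [Measure.smul_apply, Measure.smul_apply, smul_eq_mul, smul_eq_mul, mul_left_comm, ← h1]
    rfl
  · rintro f ⟨ε, hε, hf0⟩
    have h1 := hQ.tendsto_compound hα f.continuous (fun x => f.norm_coe_le_norm x) hε hf0
    have h2 := h1.div (hQ.tendsto_compound_norm (I := I) hα) hc0.ne'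
    rw [integral_smul_measure, ENNReal.toReal_ofReal (inv_nonneg.2 hc0.le), smul_eq_mul,
      inv_mul_eq_div]
    refine h2.congr' ?_
    filter_upwards [eventually_gt_atTop 0] with u hu
    have hm : Measurable fun v : I → ℝ => f (u⁻¹ • v) :=
      f.continuous.measurable.comp (measurable_const_smul _)
    rw [Pi.div_apply, mul_div_mul_left _ _ (Real.rpow_pos_of_pos hu α).ne', hnorm, ← hP' I,
      ← integral_restrict I hm]
    rfl

lemma IsTailLaw.tendsto_tail_origin (hQ : IsTailLaw α Q) (hα : 0 < α)
    (hP' : ∀ I : Finset (Fin d → ℤ), P'.map I.restrict = compound (intensity α Q I)) :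
    Tendsto (fun u : ℝ => u ^ α * P'.real {x | u < |x 0|}) atTop (𝓝 1) := by
  have h := hQ.tendsto_compound_norm (I := {0}) hα
  have hset : ∀ u : ℝ, 0 ≤ u → {v : ({0} : Finset (Fin d → ℤ)) → ℝ | u < ‖v‖} =
      {v | u < |v ⟨0, Finset.mem_singleton_self 0⟩|} := by
    intro u hu
    rw [setOf_lt_norm_eq hu]
    ext v
    rw [Set.mem_iUnion]
    constructor
    · rintro ⟨⟨i, hi⟩, h⟩
      obtain rfl := Finset.mem_singleton.1 hi
      exact h
    · exact fun h => ⟨_, h⟩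
  have hone : (blockMeasure α Q {0}).real {v | 1 < ‖v‖} = 1 := by
    rw [hset 1 zero_le_one, measureReal_def, hQ.blockMeasure_coord _ one_pos]
    simp
  rw [hone] at h
  refine h.congr' ?_
  filter_upwards [eventually_ge_atTop 0] with u hu
  rw [← hP', ← measureReal_restrict _ (measurableSet_lt_norm u), hset u hu]
  rfl

/-- The ramp confines the test function to `|v_0| > 1`, where the block measure is the marginal of
`Q`. -/
lemma IsTailLaw.tendsto_ramp (hQ : IsTailLaw α Q) (hα : 0 < α)
    (hP' : ∀ I : Finset (Fin d → ℤ), P'.map I.restrict = compound (intensity α Q I))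
    (hI : (0 : Fin d → ℤ) ∈ I) (f : (I → ℝ) →ᵇ ℝ) (n : ℕ) :
    Tendsto (fun u : ℝ => (∫ x, f (u⁻¹ • I.restrict x) * ramp n |u⁻¹ * x 0| ∂P') /
      P'.real {x | u < |x 0|}) atTop (𝓝 (∫ x, f (I.restrict x) * ramp n |x 0| ∂Q)) := by
  let g : (I → ℝ) → ℝ := fun v => f v * ramp n |v ⟨0, hI⟩|
  have hg : Continuous g := by fun_prop
  have hg0 : ∀ v : I → ℝ, |v ⟨0, hI⟩| ≤ 1 → g v = 0 := fun v hv => by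
    simp only [g, ramp_of_le hv, mul_zero]
  have hM : ∀ v, |g v| ≤ ‖f‖ := fun v => by
    rw [abs_mul]
    exact (mul_le_of_le_one_right (abs_nonneg _) (abs_ramp_le _ _)).trans (f.norm_coe_le_norm v)
  have h1 := (hQ.tendsto_compound hα hg hM one_pos fun v hv => hg0 v
    ((norm_le_pi_norm v ⟨0, hI⟩).trans hv.le)).div (hQ.tendsto_tail_origin hα hP') one_ne_zero
  have e : ∫ v, g v ∂(blockMeasure α Q I) = ∫ x, g (I.restrict x) ∂Q := by
    rw [integral_restrict I hg.measurable, ← hQ.blockMeasure_restrict hI]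
    exact (setIntegral_eq_integral_of_forall_compl_eq_zero fun v hv => hg0 v (not_lt.1 hv)).symm
  rw [div_one, e] at h1
  refine h1.congr' ?_
  filter_upwards [eventually_gt_atTop 0] with u hu
  have hm : Measurable fun v : I → ℝ => g (u⁻¹ • v) :=
    hg.measurable.comp (measurable_const_smul _)
  rw [Pi.div_apply, mul_div_mul_left _ _ (Real.rpow_pos_of_pos hu α).ne', ← hP' I,
    ← integral_restrict I hm]
  rfl

variable [IsProbabilityMeasure P']

lemma IsTailLaw.isStationary (hQ : IsTailLaw α Q)
    (hP' : ∀ I : Finset (Fin d → ℤ), P'.map I.restrict = compound (intensity α Q I)) :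
    IsStationary P' (fun x : Field d => x) := by
  classical
  intro k
  refine ⟨(measurable_shift k).aemeasurable, aemeasurable_id', ?_⟩
  rw [Measure.map_id']
  refine IsProjectiveLimit.unique (P := fun I => P'.map I.restrict) (fun I => ?_) fun I => rfl
  have : IsProbabilityMeasure (P'.map (shift k)) :=
    Measure.isProbabilityMeasure_map (measurable_shift k).aemeasurable
  let f : I → I.image (· + k) := fun i => ⟨i + k, Finset.mem_image_of_mem _ i.2⟩
  have hf : Measurable fun v : I.image (· + k) → ℝ => v ∘ f :=
    measurable_pi_lambda _ fun i => measurable_pi_apply (f i)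
  rw [Measure.map_map (by fun_prop) (measurable_shift k)]
  change _ = P'.map I.restrict
  rw [hP' I, ← hQ.map_comp_compound k f fun _ => rfl, ← hP', Measure.map_map hf (by fun_prop)]
  rfl

/-- Replacing the indicator of `|X_0| > u` by a ramp costs at most `‖f‖` times the conditional mean
of one minus the ramp. That error also converges as `u → ∞`, to a limit that is small for large `n`;
so `n` is fixed first. -/
lemma IsTailLaw.tendsto_conditional (hQ : IsTailLaw α Q) (hα : 0 < α)
    (hP' : ∀ I : Finset (Fin d → ℤ), P'.map I.restrict = compound (intensity α Q I))
    (hpos : ∀ u : ℝ, 0 < P' {x | u < |x 0|})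
    (hI : (0 : Fin d → ℤ) ∈ I) (f : (I → ℝ) →ᵇ ℝ) :
    Tendsto (fun u : ℝ => (∫ x in {x | u < |x 0|}, f (u⁻¹ • I.restrict x) ∂P') /
      P'.real {x | u < |x 0|}) atTop (𝓝 (∫ x, f (I.restrict x) ∂Q)) := by
  have := hQ.isProbabilityMeasure
  have hfm : Measurable fun x : Field d => f (I.restrict x) := by fun_prop
  have hQ0 : Q.restrict {x | 1 < |x 0|} = Q := Measure.restrict_eq_self_of_ae_mem hQ.exceeds
  have hlim := tendsto_integral_ramp (μ := Q) (F := fun x => f (I.restrict x))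
    (a := fun x => |x 0|) hfm (fun x => f.norm_coe_le_norm _) (by fun_prop)
  have hlim1 := tendsto_integral_ramp (μ := Q) (F := fun _ => 1)
    (a := fun x => |x 0|) measurable_const (fun x => (abs_one (α := ℝ)).le) (by fun_prop)
  rw [hQ0] at hlim hlim1
  have hlim2 : Tendsto (fun n : ℕ => ‖f‖ * (1 - ∫ x, (1 : ℝ) * ramp n |x 0| ∂Q)) atTop (𝓝 0) := by
    simpa using (hlim1.const_sub 1).const_mul ‖f‖
  have hcmp : ∀ n : ℕ, ∀ u : ℝ, 0 < u →
      |(∫ x in {x | u < |x 0|}, f (u⁻¹ • I.restrict x) ∂P') / P'.real {x | u < |x 0|} -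
        (∫ x, f (u⁻¹ • I.restrict x) * ramp n |u⁻¹ * x 0| ∂P') / P'.real {x | u < |x 0|}| ≤
      ‖f‖ * (1 - (∫ x, (1 : ℝ) * ramp n |u⁻¹ * x 0| ∂P') / P'.real {x | u < |x 0|}) := by
    intro n u hu
    have hp : 0 < P'.real {x | u < |x 0|} := ENNReal.toReal_pos (hpos u).ne' (measure_ne_top _ _)
    have hout : ∀ F : Field d → ℝ, ∫ x, F x * ramp n |u⁻¹ * x 0| ∂P' =
        ∫ x in {x | u < |x 0|}, F x * ramp n |u⁻¹ * x 0| ∂P' := fun F => by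
      refine (setIntegral_eq_integral_of_forall_compl_eq_zero fun x hx => ?_).symm
      rw [ramp_of_le, mul_zero]
      have : |x 0| ≤ u := not_lt.1 hx
      rw [abs_mul, abs_of_pos (inv_pos.2 hu), inv_mul_le_iff₀ hu, mul_one]
      exact this
    have hI1 : Integrable (fun x => f (u⁻¹ • I.restrict x)) (P'.restrict {x | u < |x 0|}) :=
      Integrable.of_bound (by fun_prop) ‖f‖ (ae_of_all _ fun x => f.norm_coe_le_norm _)
    have hI2 : Integrable (fun x : Field d => ramp n |u⁻¹ * x 0|)
        (P'.restrict {x | u < |x 0|}) :=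
      Integrable.of_bound (Measurable.aestronglyMeasurable (by fun_prop)) 1 (ae_of_all _ fun x => abs_ramp_le _ _)
    have hI3 : Integrable (fun x => f (u⁻¹ • I.restrict x) * ramp n |u⁻¹ * x 0|)
        (P'.restrict {x | u < |x 0|}) := hI2.bdd_mul (by fun_prop)
          (ae_of_all _ fun x => f.norm_coe_le_norm _)
    rw [hout, hout, ← sub_div, abs_div, abs_of_pos hp, ← integral_sub hI1 hI3]
    simp only [one_mul]
    have e : ‖f‖ * (1 - (∫ x in {x | u < |x 0|}, ramp n |u⁻¹ * x 0| ∂P') /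
        P'.real {x | u < |x 0|}) =
        (∫ x in {x | u < |x 0|}, ‖f‖ * (1 - ramp n |u⁻¹ * x 0|) ∂P') /
          P'.real {x | u < |x 0|} := by
      rw [integral_const_mul, integral_sub (integrable_const 1) hI2]
      simp only [integral_const, smul_eq_mul, mul_one, measureReal_restrict_apply_univ]
      field_simp
    rw [e]
    gcongr
    refine (abs_integral_le_integral_abs).trans (integral_mono_of_nonneg
      (ae_of_all _ fun _ => abs_nonneg _)
      (((integrable_const 1).sub hI2).const_mul _) (ae_of_all _ fun x => ?_))
    have h1 : f (u⁻¹ • I.restrict x) - f (u⁻¹ • I.restrict x) * ramp n |u⁻¹ * x 0| =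
        f (u⁻¹ • I.restrict x) * (1 - ramp n |u⁻¹ * x 0|) := by ring
    have h2 : 0 ≤ 1 - ramp n |u⁻¹ * x 0| := sub_nonneg.2 (ramp_le_one _ _)
    simp only
    rw [h1, abs_mul, abs_of_nonneg h2]
    exact mul_le_mul_of_nonneg_right (f.norm_coe_le_norm _) h2
  rw [Metric.tendsto_nhds]
  intro η hη
  have hη3 : 0 < η / 3 := by positivity
  obtain ⟨n, hn1, hn2⟩ := ((Metric.tendsto_nhds.1 hlim _ hη3).and
    (hlim2.eventually (gt_mem_nhds hη3))).exists
  have t1 := hQ.tendsto_ramp hα hP' hI f n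
  have t2 := ((hQ.tendsto_ramp hα hP' hI (BoundedContinuousFunction.const _ 1) n).const_sub
    1).const_mul ‖f‖
  simp only [BoundedContinuousFunction.const_apply] at t2
  filter_upwards [Metric.tendsto_nhds.1 t1 _ hη3, t2.eventually (gt_mem_nhds hn2),
    eventually_gt_atTop 0] with u h1 h2 hu
  have h3 := hcmp n u hu
  rw [← Real.dist_eq] at h3
  calc _ ≤ _ := dist_triangle4 _ _ _ _
    _ < η / 3 + η / 3 + η / 3 := add_lt_add (add_lt_add (h3.trans_lt h2) h1) hn1
    _ = η := by ring

end Construction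

lemma IsTailLaw.isTailProcess {Ω : Type*} [MeasurableSpace Ω] {P : Measure Ω} {Y : Ω → Field d}
    (hY : Measurable Y) (hQ : IsTailLaw α (P.map Y)) (hα : 0 < α) {P' : Measure (Field d)}
    [IsProbabilityMeasure P']
    (hP' : ∀ I : Finset (Fin d → ℤ), P'.map I.restrict = compound (intensity α (P.map Y) I)) :
    IsTailProcess P' (fun x : Field d => x) P Y := by
  have hpos : ∀ u : ℝ, 0 < P' {x | u < |x 0|} := by
    intro u
    -- The limit gives positivity only at high levels; lower levels follow by monotonicity.
    have h := (hQ.tendsto_tail_origin hα hP').eventually (lt_mem_nhds zero_lt_one)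
    obtain ⟨v, hv, hv0, huv⟩ := (h.and ((eventually_gt_atTop 0).and (eventually_ge_atTop u))).exists
    have h1 := pos_of_mul_pos_right hv (Real.rpow_nonneg hv0.le α)
    exact (ENNReal.toReal_pos_iff.1 h1).1.trans_le (measure_mono fun x hx => huv.trans_lt hx)
  refine ⟨(ae_map_iff hY.aemeasurable (measurableSet_exceeds 1 0)).1 hQ.exceeds, hpos,
    fun m f => ?_⟩
  have h := hQ.tendsto_conditional hα hP' hpos (zero_mem_box m) f
  rw [integral_map hY.aemeasurable (by fun_prop)] at h
  refine h.congr fun u => ?_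
  rw [ProbabilityTheory.cond, integral_smul_measure, ENNReal.toReal_inv, smul_eq_mul,
    inv_mul_eq_div, ← measureReal_def]
  rfl

lemma isTailLaw_map {Ω : Type*} [MeasurableSpace Ω] {P : Measure Ω} [IsProbabilityMeasure P]
    {Y : Ω → Field d} (hY : Measurable Y) (hY0 : ∀ ω, Y ω ∈ R0 d)
    (hES : IsExceedanceStationary P Y)
    (hpareto : P.map (fun ω => |Y ω 0|) = paretoMeasure 1 α)
    (hind : IndepFun (fun ω => |Y ω 0|) (fun ω i => Y ω i / |Y ω 0|) P) :
    IsTailLaw α (P.map Y) := by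
  refine ⟨Measure.isProbabilityMeasure_map hY.aemeasurable,
    timeChange_of_isExceedanceStationary hY hY0 hES,
    (ae_map_iff hY.aemeasurable (measurableSet_exceeds 1 0)).2 (ae_of_all _ hY0), ?_⟩
  have hm1 : Measurable fun ω => |Y ω 0| := by fun_prop
  have hm2 : Measurable fun ω i => Y ω i / |Y ω 0| := by fun_prop
  have h := (indepFun_iff_map_prod_eq_prod_map_map hm1.aemeasurable hm2.aemeasurable).1 hind
  rw [Measure.map_map (by fun_prop) hY]
  have e : P.map (normalize ∘ Y) = P.map fun ω i => Y ω i / |Y ω 0| := rfl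
  rw [e, ← hpareto, ← h, Measure.map_map (by fun_prop) (hm1.prodMk hm2)]
  congr 1
  funext ω i
  have h0 : 1 < |Y ω 0| := hY0 ω
  simp only [Function.comp_apply, Pi.smul_apply, smul_eq_mul]
  rw [mul_div_cancel₀]
  linarith

end TailField

theorem mainTheorem4 {d : ℕ} (hd : 1 ≤ d) {Ω : Type*} [MeasurableSpace Ω]
    (P : Measure Ω) [IsProbabilityMeasure P]
    (Y : Ω → TailField.Field d) (hY : Measurable Y) (hY0 : ∀ ω, Y ω ∈ TailField.R0 d)
    (α : ℝ) (hα : 0 < α) :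
    (∃ (Ω' : Type) (_ : MeasurableSpace Ω') (P' : Measure Ω') (X : Ω' → TailField.Field d),
        IsProbabilityMeasure P' ∧ Measurable X ∧
        TailField.IsStationary P' X ∧ TailField.IsRegularlyVaryingField P' X α ∧
        TailField.IsTailProcess P' X P Y) ↔
      TailField.IsExceedanceStationary P Y ∧
      P.map (fun ω => |Y ω 0|) = paretoMeasure 1 α ∧
      IndepFun (fun ω => |Y ω 0|) (fun ω i => Y ω i / |Y ω 0|) P := by
  constructor
  · rintro ⟨Ω', _, P', X, hP', hX, hst, hRV, hT⟩
    exact ⟨TailField.isExceedanceStationary_of_timeChange hY (hT.timeChange hY hst),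
      hT.map_abs hY hα hRV, hT.indepFun hY hα hRV⟩
  · rintro ⟨hES, hpareto, hind⟩
    have hQ := TailField.isTailLaw_map hY hY0 hES hpareto hind
    obtain ⟨P', hprob, hP'⟩ := hQ.exists_fieldLaw
    exact ⟨TailField.Field d, inferInstance, P', fun x => x, hprob, measurable_id,
      hQ.isStationary hP', hQ.isRegularlyVaryingField hα hP', hQ.isTailProcess hY hα hP'⟩
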